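/- Let $d\ge 1$, let $r_0>0$ and let $D\subset\mathbb{R}^d$ be a nonempty compact set. For $S\subset\mathbb{R}^d$ put $d_S(x)=\inf_{y\in S}\|x-y\|$, $b_S=d_S-d_{\mathbb{R}^d\setminus S}$ (the signed distance), $U_h(S)=\{x\in\mathbb{R}^d : d_S(x)\le h\}$ for $h>0$, and $$\operatorname{Reach}(S)=\sup\{h>0 : d_S \text{ is differentiable at every point of } U_h(S)\setminus S\}\in[0,\infty].$$ Let $\mathscr{O}_{r_0}$ be the class of all nonempty closed sets $\Omega\subset D$ such that $\Omega=\overline{\operatorname{int}\Omega}$, $\operatorname{Reach}(\partial\Omega)\ge r_0$ and $\mathcal{H}^d(\partial\Omega)=0$. A sequence $(\Omega_n)_{n\in\mathbb{N}}$ in $\mathscr{O}_{r_0}$ is said to $R$-converge to $\Omega_\infty\in\mathscr{O}_{r_0}$ if 1. $b_{\Omega_n}\to b_{\Omega_\infty}$ uniformly on $D$; 2. for all $r\in(0,r_0)$ and all $\alpha\in[0,1)$, $b_{\Omega_n}\to b_{\Omega_\infty}$ in $\mathscr{C}^{1,\alpha}(U_r(\partial\Omega_\infty))$; 3. for all $r\in(0,r_0)$,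 $b_{\Omega_n}\to b_{\Omega_\infty}$ weakly-star in $W^{2,\infty}(U_r(\partial\Omega_\infty))$, i.e. the functions and their weak derivatives of order one and two converge weakly-star in $L^\infty$ on (the interior of) $U_r(\partial\Omega_\infty)$. In 2 and 3 it is understood that $b_{\Omega_\infty}$, and $b_{\Omega_n}$ for all sufficiently large $n$ (depending on $r$ and $\alpha$), belong to the space in question. Then $\mathscr{O}_{r_0}$ is sequentially compact for $R$-convergence: every sequence in $\mathscr{O}_{r_0}$ has a subsequence that $R$-converges to some element of $\mathscr{O}_{r_0}$. -/

import Mathlib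

open Set Filter Topology MeasureTheory
open scoped NNReal ENNReal ContDiff

noncomputable section

namespace RConv

/-- The Euclidean space `ℝ^d`. -/
abbrev Eucl (d : ℕ) : Type := EuclideanSpace ℝ (Fin d)

variable {d : ℕ}

/-! ### Signed distance, tubular neighbourhoods, reach -/

/-- The signed distance `b_S = d_S - d_{ℝ^d ∖ S}`. -/
def signedDist (S : Set (Eucl d)) (x : Eucl d) : ℝ :=
  Metric.infDist x S - Metric.infDist x Sᶜ

/-- The closed tubular neighbourhood `U_h(S) = {x | d_S(x) ≤ h}`. -/
def tube (h : ℝ) (S : Set (Eucl d)) : Set (Eucl d) :=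
  {x | Metric.infDist x S ≤ h}

/-- `Reach(S) = sup {h > 0 | d_S is differentiable in U_h(S) ∖ S}`, with values in `[0, ∞]`
(the supremum of the empty set is `0`). -/
def reach (S : Set (Eucl d)) : ℝ≥0∞ :=
  sSup (ENNReal.ofReal '' {h : ℝ | 0 < h ∧
    ∀ x ∈ tube h S \ S, DifferentiableAt ℝ (fun y => Metric.infDist y S) x})

/-- The class `𝒪_{r₀}` of admissible shapes contained in `D`. The condition
`closure (interior Ω) = Ω` says that `Ω` is a genuine `d`-dimensional shape, with no
lower-dimensional pieces such as isolated points or hypersurfaces. -/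
structure IsAdmissible (D : Set (Eucl d)) (r₀ : ℝ) (Ω : Set (Eucl d)) : Prop where
  subset : Ω ⊆ D
  isClosed : IsClosed Ω
  nonempty : Ω.Nonempty
  closure_interior : closure (interior Ω) = Ω
  reach_frontier : ENNReal.ofReal r₀ ≤ reach (frontier Ω)
  null_frontier : Measure.hausdorffMeasure (d : ℝ) (frontier Ω) = 0

/-- `𝒪_{r₀}` as a set of subsets of `ℝ^d`. -/
def admissibleShapes (D : Set (Eucl d)) (r₀ : ℝ) : Set (Set (Eucl d)) :=
  {Ω | IsAdmissible D r₀ Ω}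

/-! ### Convergence in `C^{1,α}` -/

/-- The `C^{1,α}` norm on `U`: `sup |f| + sup ‖Df‖ + [Df]_α`, with values in `[0, ∞]`. -/
def c1HolderNorm (α : ℝ≥0) (U : Set (Eucl d)) (f : Eucl d → ℝ) : ℝ≥0∞ :=
  (⨆ x ∈ U, ‖f x‖ₑ) + (⨆ x ∈ U, ‖fderiv ℝ f x‖ₑ) + eHolderNorm α (U.domRestrict (fderiv ℝ f))

/-- `f` is of class `C^{1,α}` on `U`, with finite norm. For `α = 0` this is `C^1`. -/
def MemC1Holder (α : ℝ≥0) (U : Set (Eucl d)) (f : Eucl d → ℝ) : Prop :=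
  (∀ x ∈ U, DifferentiableAt ℝ f x) ∧ ContinuousOn (fderiv ℝ f) U ∧ c1HolderNorm α U f < ⊤

/-- `f n → g` in `C^{1,α}(U)`: the limit and all but finitely many terms belong to the space, and
the norm of the difference tends to `0`. -/
def TendstoC1Holder (α : ℝ≥0) (U : Set (Eucl d)) (f : ℕ → Eucl d → ℝ) (g : Eucl d → ℝ) : Prop :=
  (∀ᶠ n in atTop, MemC1Holder α U (f n)) ∧ MemC1Holder α U g ∧
    Tendsto (fun n => c1HolderNorm α U (fun x => f n x - g x)) atTop (𝓝 0)

/-! ### Weak-star convergence in `W^{2,∞}` -/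

/-- `f` belongs to `L^∞(V)`. -/
def MemLInf (V : Set (Eucl d)) (f : Eucl d → ℝ) : Prop :=
  MemLp f ⊤ (volume.restrict V)

/-- `g` is the weak partial derivative `∂_i f` on the open set `V`. -/
def IsWeakPartial (V : Set (Eucl d)) (i : Fin d) (f g : Eucl d → ℝ) : Prop :=
  ∀ φ : Eucl d → ℝ, ContDiff ℝ ∞ φ → HasCompactSupport φ → tsupport φ ⊆ V →
    ∫ x in V, f x * fderiv ℝ φ x (EuclideanSpace.single i 1) = - ∫ x in V, g x * φ x

/-- `f ∈ W^{2,∞}(V)`, with weak first derivatives `G i = ∂_i f` and weak second derivatives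
`H i j = ∂_j ∂_i f`. -/
structure IsW2Inf (V : Set (Eucl d)) (f : Eucl d → ℝ) (G : Fin d → Eucl d → ℝ)
    (H : Fin d → Fin d → Eucl d → ℝ) : Prop where
  mem : MemLInf V f
  mem_fst : ∀ i, MemLInf V (G i)
  mem_snd : ∀ i j, MemLInf V (H i j)
  weak_fst : ∀ i, IsWeakPartial V i f (G i)
  weak_snd : ∀ i j, IsWeakPartial V j (G i) (H i j)

/-- Weak-star convergence in `L^∞(V) = L^1(V)'`. -/
def TendstoWeakStarLInf (V : Set (Eucl d)) (f : ℕ → Eucl d → ℝ) (g : Eucl d → ℝ) : Prop :=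
  ∀ ψ : Eucl d → ℝ, Integrable ψ (volume.restrict V) →
    Tendsto (fun n => ∫ x in V, f n x * ψ x) atTop (𝓝 (∫ x in V, g x * ψ x))

/-- Weak-star convergence in `W^{2,∞}(V)`, `V` open: the limit and all but finitely many terms
belong to `W^{2,∞}(V)`, and the functions and their weak derivatives of order one and two (which
are unique almost everywhere) converge weakly-star in `L^∞(V)`. -/
def TendstoWeakStarW2Inf (V : Set (Eucl d)) (f : ℕ → Eucl d → ℝ) (g : Eucl d → ℝ) : Prop :=
  ∃ (G : ℕ → Fin d → Eucl d → ℝ) (H : ℕ → Fin d → Fin d → Eucl d → ℝ)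
    (G' : Fin d → Eucl d → ℝ) (H' : Fin d → Fin d → Eucl d → ℝ),
    (∀ᶠ n in atTop, IsW2Inf V (f n) (G n) (H n)) ∧ IsW2Inf V g G' H' ∧
    TendstoWeakStarLInf V f g ∧
    (∀ i, TendstoWeakStarLInf V (fun n => G n i) (G' i)) ∧
    (∀ i j, TendstoWeakStarLInf V (fun n => H n i j) (H' i j))

/-! ### `R`-convergence -/

/-- `R`-convergence of a sequence of shapes in `𝒪_{r₀}` to a shape. -/
structure RConverges (D : Set (Eucl d)) (r₀ : ℝ) (Ω : ℕ → Set (Eucl d)) (Ω' : Set (Eucl d)) :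
    Prop where
  unif : TendstoUniformlyOn (fun n => signedDist (Ω n)) (signedDist Ω') atTop D
  holder : ∀ r : ℝ, 0 < r → r < r₀ → ∀ α : ℝ≥0, α < 1 →
    TendstoC1Holder α (tube r (frontier Ω')) (fun n => signedDist (Ω n)) (signedDist Ω')
  weakStar : ∀ r : ℝ, 0 < r → r < r₀ →
    TendstoWeakStarW2Inf (interior (tube r (frontier Ω')))
      (fun n => signedDist (Ω n)) (signedDist Ω')

end RConv

end

/-! The reach condition becomes compact once it is written through the signed distance. If `d_Γ` is
differentiable up to distance `r₀` from `Γ = ∂Ω`, a normal segment can be prolonged to length `r₀`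
with its foot still nearest. As `Ω` is the closure of its interior, each point of `Γ` is approached
from both sides, so it carries a unit `ν` with `b(x + r₀ν) ≥ r₀` and `b(x - r₀ν) ≤ -r₀`. This
property, `IsTwoSided`, consists of non-strict inequalities, so it survives uniform limits.
Conversely, it makes `{b ≤ 0}` admissible, with frontier `Γ`.

For compactness, Blaschke selection is applied to the sets and to their frontiers; since `b = 2 d_Ω
- d_∂Ω`, the signed distances converge uniformly on the whole space. The limit is again two-sided,
which identifies it as the signed distance of an admissible set.

For the finer convergence, the two tangent balls squeeze `b` between two distance functions. On
`{|b| ≤ r}` this gives a Taylor error of at most `‖w‖² / (2(r₀ - r))`, uniformly along the sequence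
(`QuadApprox`). The gradients are then equi-Lipschitz, and interpolation against uniform convergence
gives uniform, then `C^{1,α}`, convergence. Second derivatives are bounded, so testing against
smooth functions, dense in `L¹`, gives weak-star convergence. -/

noncomputable section

namespace RConv

variable {d : ℕ}

/-! ### Distance to the frontier -/

section Frontier

variable {E : Type*} [NormedAddCommGroup E] [NormedSpace ℝ E]

theorem exists_mem_frontier_dist_add_dist {S : Set E} {x y : E} (hx : x ∈ S) (hy : y ∉ S) :
    ∃ q ∈ frontier S, dist x q + dist q y = dist x y := by
  by_contra! h
  -- A segment missing the frontier would be covered by two disjoint open sets, against its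
  -- connectedness.
  have hsub : segment ℝ x y ⊆ interior S ∪ interior Sᶜ := by
    intro q hq
    by_contra hq'
    refine h q ?_ (dist_add_dist_of_mem_segment hq)
    rw [mem_union, not_or] at hq'
    rw [frontier_eq_closure_inter_closure, ← compl_compl (closure S), ← interior_compl]
    refine ⟨hq'.2, ?_⟩
    rw [← compl_compl (closure Sᶜ), ← interior_compl, compl_compl]
    exact hq'.1
  have hdisj : Disjoint (interior S) (interior Sᶜ) :=
    disjoint_compl_right.mono interior_subset interior_subset
  rcases IsPreconnected.subset_or_subset isOpen_interior isOpen_interior hdisj hsub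
    (convex_segment x y).isPreconnected with h1 | h1
  · exact hy (interior_subset (h1 (right_mem_segment ℝ x y)))
  · exact interior_subset (h1 (left_mem_segment ℝ x y)) hx

theorem infDist_frontier_of_mem {S : Set E} {x : E} (hx : x ∈ S) (hne : Sᶜ.Nonempty) :
    Metric.infDist x (frontier S) = Metric.infDist x Sᶜ := by
  obtain ⟨y₀, hy₀⟩ := hne
  obtain ⟨q₀, hq₀, -⟩ := exists_mem_frontier_dist_add_dist hx hy₀
  apply le_antisymm
  · rw [Metric.le_infDist ⟨y₀, hy₀⟩]
    intro y hy
    obtain ⟨q, hq, h⟩ := exists_mem_frontier_dist_add_dist hx hy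
    have := Metric.infDist_le_dist_of_mem (x := x) hq
    have := dist_nonneg (x := q) (y := y)
    linarith
  · rw [← Metric.infDist_closure (s := Sᶜ)]
    refine Metric.infDist_le_infDist_of_subset ?_ ⟨q₀, hq₀⟩
    rw [← frontier_compl]
    exact frontier_subset_closure

end Frontier

/-! ### The signed distance -/

section SignedDist

variable {S : Set (Eucl d)} {x y : Eucl d}

theorem signedDist_of_mem (hne : Sᶜ.Nonempty) (hx : x ∈ S) :
    signedDist S x = -Metric.infDist x (frontier S) := by
  rw [signedDist, infDist_frontier_of_mem hx hne, Metric.infDist_zero_of_mem hx, zero_sub]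

theorem signedDist_of_notMem (hne : S.Nonempty) (hx : x ∉ S) :
    signedDist S x = Metric.infDist x (frontier S) := by
  rw [signedDist, ← frontier_compl, infDist_frontier_of_mem (S := Sᶜ) hx (by simpa using hne),
    Metric.infDist_zero_of_mem (s := Sᶜ) hx, sub_zero, compl_compl]

theorem abs_signedDist (hS : S.Nonempty) (hne : Sᶜ.Nonempty) (x : Eucl d) :
    |signedDist S x| = Metric.infDist x (frontier S) := by
  by_cases hx : x ∈ S
  · rw [signedDist_of_mem hne hx, abs_neg, abs_of_nonneg Metric.infDist_nonneg]
  · rw [signedDist_of_notMem hS hx, abs_of_nonneg Metric.infDist_nonneg]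

/-- This form involves only distances to `S` and its frontier, which for admissible shapes are
compact subsets of `D`; the unbounded complement has disappeared. -/
theorem signedDist_eq_two_mul_sub (hS : S.Nonempty) (hne : Sᶜ.Nonempty) (x : Eucl d) :
    signedDist S x = 2 * Metric.infDist x S - Metric.infDist x (frontier S) := by
  by_cases hx : x ∈ S
  · rw [signedDist_of_mem hne hx, Metric.infDist_zero_of_mem hx]; ring
  · have h := signedDist_of_notMem hS hx
    have h' : signedDist S x = Metric.infDist x S := by
      rw [signedDist, Metric.infDist_zero_of_mem (s := Sᶜ) hx, sub_zero]
    linarith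

theorem signedDist_sub_le (hS : S.Nonempty) (hne : Sᶜ.Nonempty) (x y : Eucl d) :
    signedDist S x - signedDist S y ≤ dist x y := by
  have hd (x y : Eucl d) : Metric.infDist x (frontier S) ≤
    Metric.infDist y (frontier S) + dist x y := Metric.infDist_le_infDist_add_dist
  have h0 (x : Eucl d) : 0 ≤ Metric.infDist x (frontier S) := Metric.infDist_nonneg
  by_cases hx : x ∈ S <;> by_cases hy : y ∈ S
  · rw [signedDist_of_mem hne hx, signedDist_of_mem hne hy]
    have := hd y x
    rw [dist_comm] at this
    linarith
  · rw [signedDist_of_mem hne hx, signedDist_of_notMem hS hy]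
    have := h0 x; have := h0 y; have := dist_nonneg (x := x) (y := y)
    linarith
  · rw [signedDist_of_notMem hS hx, signedDist_of_mem hne hy]
    obtain ⟨q, hq, h⟩ := exists_mem_frontier_dist_add_dist hy hx
    have h1 := Metric.infDist_le_dist_of_mem (x := x) hq
    have h2 := Metric.infDist_le_dist_of_mem (x := y) hq
    rw [dist_comm q x, dist_comm y x] at h
    linarith
  · rw [signedDist_of_notMem hS hx, signedDist_of_notMem hS hy]
    linarith [hd x y]

theorem lipschitzWith_signedDist (hS : S.Nonempty) (hne : Sᶜ.Nonempty) :
    LipschitzWith 1 (signedDist S) :=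
  LipschitzWith.of_le_add fun x y => by linarith [signedDist_sub_le hS hne x y]

end SignedDist

/-! ### Normal rays of a set whose distance function is differentiable -/

section Rays

variable {E : Type*} [NormedAddCommGroup E] [InnerProductSpace ℝ E]
  {S : Set E} {x p q : E} {r₀ : ℝ}

/-- The function `d_S - ‖· - p‖` is nonpositive and vanishes at `x`, so the two derivatives agree
there. -/
theorem fderiv_infDist_apply_self (hp : p ∈ S) (hd : dist x p = Metric.infDist x S)
    (hpos : 0 < Metric.infDist x S)
    (hdiff : DifferentiableAt ℝ (fun y => Metric.infDist y S) x) :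
    fderiv ℝ (fun y => Metric.infDist y S) x (x - p) = Metric.infDist x S := by
  have hne : x - p ≠ 0 := by
    rw [← norm_pos_iff, ← dist_eq_norm, hd]; exact hpos
  have hn : DifferentiableAt ℝ (fun y : E => ‖y‖) (x - p) :=
    (contDiffAt_norm ℝ hne (n := 1)).differentiableAt (by simp)
  have hn' : HasFDerivAt (fun y : E => ‖y - p‖) (fderiv ℝ (fun y : E => ‖y‖) (x - p)) x := 
    hn.hasFDerivAt.comp x ((hasFDerivAt_id x).sub_const p)
  have hmax : IsLocalMax (fun y => Metric.infDist y S - ‖y - p‖) x := by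
    refine Eventually.of_forall fun y => ?_
    have := Metric.infDist_le_dist_of_mem (x := y) hp
    rw [dist_eq_norm] at this hd
    simp only [hd, sub_self]
    linarith
  have h := hmax.hasFDerivAt_eq_zero (hdiff.hasFDerivAt.sub hn')
  have h' := congrArg (fun L : E →L[ℝ] ℝ => L (x - p)) h
  simp only [sub_apply, zero_apply,
    hn.fderiv_norm_self] at h'
  rw [← hd, dist_eq_norm]
  linarith

theorem fderiv_infDist_apply_le (x w : E) :
    fderiv ℝ (fun y => Metric.infDist y S) x w ≤ ‖w‖ := by
  have h := norm_fderiv_le_of_lipschitz ℝ (Metric.lipschitz_infDist_pt S) (x₀ := x)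
  have h' := (fderiv ℝ (fun y => Metric.infDist y S) x).le_of_opNorm_le h w
  simpa using (le_abs_self _).trans h'

/-- The derivative, of norm at most one, attains its norm on both `x - p` and `x - q`; strict
convexity forces these to coincide. -/
theorem eq_of_dist_eq_infDist (hp : p ∈ S) (hq : q ∈ S) (hdp : dist x p = Metric.infDist x S)
    (hdq : dist x q = Metric.infDist x S) (hpos : 0 < Metric.infDist x S)
    (hdiff : DifferentiableAt ℝ (fun y => Metric.infDist y S) x) : p = q := by
  have h1 := fderiv_infDist_apply_self hp hdp hpos hdiff
  have h2 := fderiv_infDist_apply_self hq hdq hpos hdiff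
  have h3 := fderiv_infDist_apply_le (S := S) x ((x - p) + (x - q))
  rw [map_add, h1, h2] at h3
  rw [dist_eq_norm] at hdp hdq
  have h4 := norm_add_le (x - p) (x - q)
  have := eq_of_norm_eq_of_norm_add_eq (x := x - p) (y := x - q) (by rw [hdp, hdq])
    (by apply le_antisymm h4; rw [hdp, hdq]; exact h3)
  simpa using this

variable [FiniteDimensional ℝ E]

/-- Let `z` maximize `d_S` over the ball of radius `ε` about `x`. The first-order condition at `z`
and strict convexity put `z - x` along the gradient `u` at `z`. Hence `x` lies on the segment from
`z` to its nearest point `q`, so `q` is also nearest to `x` and equals `p` by uniqueness. -/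
theorem infDist_add_smul_sub (hS : IsClosed S) (hp : p ∈ S)
    (hdp : dist x p = Metric.infDist x S) {ε : ℝ} (hε : 0 < ε) (hεx : ε < Metric.infDist x S)
    (hr : Metric.infDist x S + ε < r₀)
    (hdiff : ∀ z, 0 < Metric.infDist z S → Metric.infDist z S < r₀ →
      DifferentiableAt ℝ (fun y => Metric.infDist y S) z) :
    Metric.infDist (x + (ε / Metric.infDist x S) • (x - p)) S = Metric.infDist x S + ε := by
  have : ProperSpace E := FiniteDimensional.proper ℝ E
  have hcont : Continuous fun y => Metric.infDist y S := Metric.continuous_infDist_pt S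
  obtain ⟨z, hz, hmax⟩ := (isCompact_closedBall x ε).exists_isMaxOn
    ⟨x, Metric.mem_closedBall_self hε.le⟩ hcont.continuousOn
  have hxz : Metric.infDist x S ≤ Metric.infDist z S := hmax (Metric.mem_closedBall_self hε.le)
  have hzx : Metric.infDist z S ≤ Metric.infDist x S + dist z x :=
    Metric.infDist_le_infDist_add_dist
  have hzε : dist z x ≤ ε := hz
  have hz0 : 0 < Metric.infDist z S := by linarith
  have hzd := hdiff z hz0 (by linarith)
  obtain ⟨q, hq, hdq⟩ := hS.exists_infDist_eq_dist ⟨p, hp⟩ z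
  have hLq := fderiv_infDist_apply_self hq hdq.symm hz0 hzd
  set δ := Metric.infDist z S with hδ
  set L := fderiv ℝ (fun y => Metric.infDist y S) z with hL
  have hnu : ‖z - q‖ = δ := by rw [hdq, dist_eq_norm]
  set u := δ⁻¹ • (z - q) with hu
  have hun : ‖u‖ = 1 := by
    rw [hu, norm_smul, hnu, norm_inv, Real.norm_of_nonneg hz0.le, inv_mul_cancel₀ hz0.ne']
  have hLu : L u = 1 := by
    rw [hu, map_smul, hLq, smul_eq_mul, inv_mul_cancel₀ hz0.ne']
  have hmem : x + ε • u ∈ Metric.closedBall x ε := by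
    simp [norm_smul, hun, abs_of_pos hε]
  have hneg : L ((x + ε • u) - z) ≤ 0 :=
    hmax.localize.hasFDerivWithinAt_nonpos hzd.hasFDerivAt.hasFDerivWithinAt
      (sub_mem_posTangentConeAt_of_segment_subset
        ((convex_closedBall x ε).segment_subset hz hmem))
  have hge : ε + ε ≤ ‖(z - x) + ε • u‖ := by
    refine le_trans ?_ (fderiv_infDist_apply_le (S := S) z _)
    rw [← hL]
    have : (x + ε • u) - z = ε • u - (z - x) := by abel
    rw [this, map_sub, map_smul, hLu] at hneg
    rw [map_add, map_smul, hLu]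
    simp only [smul_eq_mul, mul_one] at hneg ⊢
    linarith
  have hεu : ‖ε • u‖ = ε := by simp [norm_smul, hun, abs_of_pos hε]
  rw [dist_eq_norm] at hzε
  have hadd := norm_add_le (z - x) (ε • u)
  have hzx' : z - x = ε • u :=
    eq_of_norm_eq_of_norm_add_eq (by linarith) (by linarith)
  have hxq : x - q = (δ - ε) • u := by
    have h1 : z - q = δ • u := by rw [hu, smul_inv_smul₀ hz0.ne']
    rw [sub_smul, ← h1, ← hzx']; abel
  have hxqd : dist x q = δ - ε := by
    rw [dist_eq_norm, hxq, norm_smul, hun, mul_one, Real.norm_of_nonneg (by linarith)]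
  have hxδ : Metric.infDist x S = δ - ε := by
    have := Metric.infDist_le_dist_of_mem (x := x) hq
    have : δ ≤ Metric.infDist x S + ε := by linarith [dist_eq_norm z x]
    linarith
  have hpq : p = q := eq_of_dist_eq_infDist hp hq hdp (by rw [hxqd, hxδ]) (by linarith)
    (hdiff x (by linarith) (by linarith))
  have hne : δ - ε ≠ 0 := by linarith
  rw [hpq, hxq, hxδ, smul_smul, div_mul_cancel₀ _ hne, ← hzx', add_sub_cancel, ← hδ]
  ring

/-- If the distance to `S` is differentiable up to distance `r₀`, then the normal rays of `S`
realize the distance to `S` up to length `r₀`. -/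
theorem le_infDist_add_smul (hS : IsClosed S) {ν : E} (hν : ‖ν‖ = 1) (hp : p ∈ S) {s : ℝ}
    (hs : 0 < s) (hsr : s < r₀) (hps : Metric.infDist (p + s • ν) S = s)
    (hdiff : ∀ z, 0 < Metric.infDist z S → Metric.infDist z S < r₀ →
      DifferentiableAt ℝ (fun y => Metric.infDist y S) z) :
    r₀ ≤ Metric.infDist (p + r₀ • ν) S := by
  have hcont : Continuous fun t : ℝ => Metric.infDist (p + t • ν) S :=
    (Metric.continuous_infDist_pt S).comp (by fun_prop)
  have key : ∀ r, s < r → r < r₀ → Metric.infDist (p + r • ν) S = r := by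
    intro r hsr hr
    have hT : IsCompact (Icc s r ∩ {t | Metric.infDist (p + t • ν) S = t}) :=
      isCompact_Icc.inter_right (isClosed_eq hcont continuous_id)
    obtain ⟨τ, ⟨⟨hτs, hτr⟩, hτ⟩, hτmax⟩ := hT.exists_isGreatest ⟨s, ⟨le_rfl, hsr.le⟩, hps⟩
    rcases hτr.eq_or_lt with rfl | hlt
    · exact hτ
    exfalso
    have hτ0 : 0 < τ := hs.trans_le hτs
    -- The prolongation needs `ε < τ` and `τ + ε < r₀`; staying below `r` contradicts the maximality
    -- of `τ`.
    set ε := min τ (r - τ) / 2 with hε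
    have hε0 : 0 < ε := by have := lt_min hτ0 (sub_pos.2 hlt); positivity
    have hε1 : ε ≤ τ / 2 := by rw [hε]; gcongr; exact min_le_left _ _
    have hε2 : ε ≤ (r - τ) / 2 := by rw [hε]; gcongr; exact min_le_right _ _
    have hτ' : Metric.infDist (p + τ • ν) S = τ := hτ
    have h := infDist_add_smul_sub (x := p + τ • ν) (r₀ := r₀) hS hp
      (by rw [hτ', dist_eq_norm]; simp [norm_smul, hν, abs_of_pos hτ0]) hε0
      (by rw [hτ']; linarith) (by rw [hτ']; linarith) hdiff
    rw [hτ', add_sub_cancel_left, smul_smul, div_mul_cancel₀ _ hτ0.ne', add_assoc,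
      ← add_smul] at h
    have := hτmax ⟨⟨by linarith, by linarith⟩, h⟩
    linarith
  refine le_of_forall_lt fun r hr => ?_
  -- From `t` to `r₀` the distance drops by at most `r₀ - t`, leaving `2t - r₀ > r`.
  obtain ⟨t, ht, htr⟩ := exists_between (show max ((r + r₀) / 2) s < r₀ from
    max_lt (by linarith) hsr)
  rw [max_lt_iff] at ht
  have hk := key t ht.2 htr
  have hl := Metric.infDist_le_infDist_add_dist (s := S) (x := p + t • ν) (y := p + r₀ • ν)
  rw [hk, dist_eq_norm, add_sub_add_left_eq_sub, ← sub_smul, norm_smul, hν, mul_one,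
    Real.norm_eq_abs, abs_of_neg (by linarith)] at hl
  linarith

end Rays

/-! ### Signed distances with two-sided tangent balls -/

section TwoSided

theorem LipschitzWith.sub_le_norm {E : Type*} [SeminormedAddCommGroup E] {f : E → ℝ}
    (hf : LipschitzWith 1 f) (x y : E) : f x - f y ≤ ‖x - y‖ := by
  have := hf.dist_le_mul x y
  rw [Real.dist_eq, NNReal.coe_one, one_mul, dist_eq_norm] at this
  exact (le_abs_self _).trans this

variable {E : Type*} [NormedAddCommGroup E] [InnerProductSpace ℝ E]

/-- `b` behaves like the signed distance to an oriented hypersurface `Γ` such that at every point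
of `Γ` there are tangent balls of radius `r₀` on both sides of `Γ`. -/
structure IsTwoSided (r₀ : ℝ) (b : E → ℝ) (Γ : Set E) : Prop where
  isCompact : IsCompact Γ
  nonempty : Γ.Nonempty
  lipschitz : LipschitzWith 1 b
  abs_eq : ∀ x, |b x| = Metric.infDist x Γ
  exists_normal : ∀ x ∈ Γ, ∃ ν : E, ‖ν‖ = 1 ∧ r₀ ≤ b (x + r₀ • ν) ∧ b (x - r₀ • ν) ≤ -r₀

variable {Γ : Set E} {r₀ : ℝ}

/-- Points with `g < 0` near `x` have nearest points in `Γ` whose rays reach length `r₀`. The base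
points of such rays form a closed set, by compactness of the unit sphere, so `x` belongs to it. -/
theorem exists_unit_apply_le [FiniteDimensional ℝ E] {g : E → ℝ} (hΓ : IsCompact Γ)
    (hg : LipschitzWith 1 g) (habs : ∀ x, |g x| = Metric.infDist x Γ) (hr₀ : 0 < r₀)
    (hdiff : ∀ z, 0 < Metric.infDist z Γ → Metric.infDist z Γ < r₀ →
      DifferentiableAt ℝ (fun y => Metric.infDist y Γ) z)
    {x : E} (hx : x ∈ Γ) (hxc : x ∈ closure {y | g y < 0}) :
    ∃ η : E, ‖η‖ = 1 ∧ g (x + r₀ • η) ≤ -r₀ := by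
  have : ProperSpace E := FiniteDimensional.proper ℝ E
  have hcl : IsClosed (Prod.fst '' ((Γ ×ˢ Metric.sphere (0 : E) 1) ∩
      {P : E × E | g (P.1 + r₀ • P.2) ≤ -r₀})) := by
    refine (IsCompact.image (IsCompact.inter_right (hΓ.prod (isCompact_sphere 0 1)) ?_)
      continuous_fst).isClosed
    exact isClosed_le (hg.continuous.comp (by fun_prop)) continuous_const
  suffices h : x ∈ Prod.fst '' ((Γ ×ˢ Metric.sphere (0 : E) 1) ∩
      {P : E × E | g (P.1 + r₀ • P.2) ≤ -r₀}) by
    obtain ⟨⟨x', η⟩, ⟨⟨-, hη⟩, hP⟩, rfl⟩ := h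
    exact ⟨η, by simpa using hη, hP⟩
  rw [← hcl.closure_eq, Metric.mem_closure_iff]
  intro ε hε
  -- The foot of `y` is at most twice as far from `x` as `y` is, hence `ε / 2`; the bound `r₀` keeps
  -- `y` where the ray lemma applies.
  obtain ⟨y, hy, hxy⟩ := Metric.mem_closure_iff.1 hxc (min (ε / 2) r₀)
    (lt_min (by positivity) hr₀)
  obtain ⟨hxy1, hxy2⟩ := lt_min_iff.1 hxy
  obtain ⟨p, hp, hyp⟩ := hΓ.isClosed.exists_infDist_eq_dist ⟨x, hx⟩ y
  have hyx : Metric.infDist y Γ ≤ dist x y := by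
    rw [dist_comm]; exact Metric.infDist_le_dist_of_mem hx
  set s := Metric.infDist y Γ with hs
  have hgy : g y = -s := by
    have := habs y
    rw [abs_of_neg hy] at this
    linarith
  have hs0 : 0 < s := by have : g y < 0 := hy; linarith
  have hsn : ‖y - p‖ = s := by rw [← dist_eq_norm, hyp]
  set η := s⁻¹ • (y - p) with hη
  have hηn : ‖η‖ = 1 := by
    rw [hη, norm_smul, hsn, norm_inv, Real.norm_of_nonneg hs0.le, inv_mul_cancel₀ hs0.ne']
  have hpy : p + s • η = y := by rw [hη, smul_inv_smul₀ hs0.ne', add_sub_cancel]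
  have hray := le_infDist_add_smul hΓ.isClosed hηn hp hs0 (by linarith) (by rw [hpy]) hdiff
  refine ⟨p, ⟨(p, η), ⟨⟨hp, by simpa using hηn⟩, ?_⟩, rfl⟩, ?_⟩
  · rw [← habs] at hray
    have h1 := LipschitzWith.sub_le_norm hg (p + r₀ • η) y
    rw [← hpy, add_sub_add_left_eq_sub, ← sub_smul, norm_smul, hηn, mul_one,
      Real.norm_of_nonneg (by linarith), hpy] at h1
    -- The sign cannot flip: the Lipschitz bound gives `g (p + r₀ • η) ≤ r₀ - 2s < r₀`.
    rcases le_abs.1 hray with h | h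
    · linarith
    · change g (p + r₀ • η) ≤ -r₀
      linarith
  · linarith [dist_triangle x y p]

theorem eq_neg_of_two_le_norm_sub {μ η : E} (hμ : ‖μ‖ = 1) (hη : ‖η‖ = 1)
    (h : 2 ≤ ‖μ - η‖) : η = -μ := by
  have h1 := parallelogram_law_with_norm ℝ μ η
  rw [hμ, hη] at h1
  have h2 : ‖μ + η‖ = 0 := by nlinarith [norm_nonneg (μ + η)]
  rw [norm_eq_zero] at h2
  exact (neg_eq_of_add_eq_zero_right h2).symm

/-- A closed set whose frontier has reach at least `r₀` has two-sided tangent balls, provided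
that no point of the frontier is isolated from the interior or from the complement. -/
theorem isTwoSided_of_differentiableAt [FiniteDimensional ℝ E] {b : E → ℝ} (hΓ : IsCompact Γ)
    (hne : Γ.Nonempty) (hb : LipschitzWith 1 b) (habs : ∀ x, |b x| = Metric.infDist x Γ)
    (hr₀ : 0 < r₀)
    (hdiff : ∀ z, 0 < Metric.infDist z Γ → Metric.infDist z Γ < r₀ →
      DifferentiableAt ℝ (fun y => Metric.infDist y Γ) z)
    (hneg : Γ ⊆ closure {y | b y < 0}) (hpos : Γ ⊆ closure {y | 0 < b y}) :
    IsTwoSided r₀ b Γ := by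
  refine ⟨hΓ, hne, hb, habs, fun x hx => ?_⟩
  obtain ⟨η, hη, hbη⟩ := exists_unit_apply_le hΓ hb habs hr₀ hdiff hx (hneg hx)
  obtain ⟨ν, hν, hbν⟩ := exists_unit_apply_le (g := fun y => -b y) hΓ hb.neg
    (fun y => by rw [abs_neg, habs]) hr₀ hdiff hx (by simpa using hpos hx)
  have h := LipschitzWith.sub_le_norm hb (x + r₀ • ν) (x + r₀ • η)
  rw [add_sub_add_left_eq_sub, ← smul_sub, norm_smul, Real.norm_of_nonneg hr₀.le] at h
  -- The values of `b` at the two centres differ by at least `2r₀`, so the unit directions are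
  -- antipodal.
  have h2 : 2 ≤ ‖ν - η‖ := by
    by_contra! hc
    nlinarith
  have := eq_neg_of_two_le_norm_sub hν hη h2
  subst this
  exact ⟨ν, hν, by linarith, by simpa [sub_eq_add_neg] using hbη⟩

open scoped RealInnerProductSpace

/-- With `N` the left-hand norm, the right side is `(N² + ρ²) / (2ρ)`, so the gap is a square over
`2ρ`. -/
theorem norm_smul_add_le {ν w : E} (hν : ‖ν‖ = 1) {ρ : ℝ} (hρ : 0 < ρ) :
    ‖ρ • ν + w‖ ≤ ρ + ⟪ν, w⟫ + ‖w‖ ^ 2 / (2 * ρ) := by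
  have h1 : ‖ρ • ν + w‖ ^ 2 = ρ ^ 2 + 2 * (ρ * ⟪ν, w⟫) + ‖w‖ ^ 2 := by
    rw [norm_add_sq_real, norm_smul, hν, real_inner_smul_left, Real.norm_of_nonneg hρ.le]
    ring
  have h2 : ρ + ⟪ν, w⟫ + ‖w‖ ^ 2 / (2 * ρ) - ‖ρ • ν + w‖ = (‖ρ • ν + w‖ - ρ) ^ 2 / (2 * ρ) := by
    field_simp
    linear_combination -h1
  have h3 : 0 ≤ (‖ρ • ν + w‖ - ρ) ^ 2 / (2 * ρ) := by positivity
  linarith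

theorem eq_smul_of_le_norm_add {ν v : E} (hν : ‖ν‖ = 1) (hr₀ : 0 < r₀)
    (h : ‖v‖ + r₀ ≤ ‖v + r₀ • ν‖) : v = ‖v‖ • ν := by
  have hr : ‖r₀ • ν‖ = r₀ := by rw [norm_smul, hν, mul_one, Real.norm_of_nonneg hr₀.le]
  have h1 : ‖v + r₀ • ν‖ = ‖v‖ + ‖r₀ • ν‖ := le_antisymm (norm_add_le _ _) (by rwa [hr])
  have h2 := norm_add_eq_iff_real.1 h1
  rw [hr, smul_comm] at h2
  exact smul_right_injective E hr₀.ne' h2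

namespace IsTwoSided

variable {b : E → ℝ}

theorem exists_eq_add_smul [FiniteDimensional ℝ E] (h : IsTwoSided r₀ b Γ) (hr₀ : 0 < r₀)
    (y : E) : ∃ p ∈ Γ, ∃ ν : E, ‖ν‖ = 1 ∧ r₀ ≤ b (p + r₀ • ν) ∧ b (p - r₀ • ν) ≤ -r₀ ∧
      y = p + b y • ν := by
  have : ProperSpace E := FiniteDimensional.proper ℝ E
  obtain ⟨p, hp, hyp⟩ := h.isCompact.isClosed.exists_infDist_eq_dist h.nonempty y
  obtain ⟨ν, hν, h1, h2⟩ := h.exists_normal p hp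
  refine ⟨p, hp, ν, hν, h1, h2, ?_⟩
  rw [← h.abs_eq, dist_eq_norm] at hyp
  rw [← sub_eq_iff_eq_add']
  rcases le_total 0 (b y) with hs | hs
  · rw [abs_of_nonneg hs] at hyp
    rw [hyp]
    refine eq_smul_of_le_norm_add hν hr₀ ?_
    have := LipschitzWith.sub_le_norm h.lipschitz y (p - r₀ • ν)
    rw [show y - p + r₀ • ν = y - (p - r₀ • ν) by abel]
    linarith
  · rw [abs_of_nonpos hs] at hyp
    have key := eq_smul_of_le_norm_add (r₀ := r₀) (ν := -ν) (v := y - p) (by rwa [norm_neg]) hr₀ (by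
      have := LipschitzWith.sub_le_norm h.lipschitz (p + r₀ • ν) y
      rw [show y - p + r₀ • -ν = y - (p + r₀ • ν) by rw [smul_neg]; abel,
        norm_sub_rev y (p + r₀ • ν)]
      linarith)
    rw [← hyp] at key
    rw [key]; simp

/-- In the open tube of radius `r₀` the function `b` has second-order Taylor expansions with
explicit quadratic error. -/
theorem exists_abs_sub_inner_le [FiniteDimensional ℝ E] (h : IsTwoSided r₀ b Γ) (hr₀ : 0 < r₀)
    {y : E} {r : ℝ} (hy : |b y| ≤ r) (hr : r < r₀) :
    ∃ ν : E, ‖ν‖ = 1 ∧ ∀ w, |b (y + w) - b y - ⟪ν, w⟫| ≤ (2 * (r₀ - r))⁻¹ * ‖w‖ ^ 2 := by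
  obtain ⟨p, hp, ν, hν, h1, h2, hpy⟩ := h.exists_eq_add_smul hr₀ y
  refine ⟨ν, hν, fun w => ?_⟩
  obtain ⟨hy1, hy2⟩ := abs_le.1 hy
  have aux (ρ : ℝ) (hρ : r₀ - r ≤ ρ) :
      ‖w‖ ^ 2 / (2 * ρ) ≤ (2 * (r₀ - r))⁻¹ * ‖w‖ ^ 2 := by
    rw [inv_mul_eq_div]
    have : 0 < r₀ - r := by linarith
    gcongr
  -- The distances to the centres of the two tangent balls bound `b` from above and below. These
  -- centres are `r₀ ± b y ≥ r₀ - r` away from `y`, which gives the constant.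
  have hup := LipschitzWith.sub_le_norm h.lipschitz (y + w) (p - r₀ • ν)
  have hlo := LipschitzWith.sub_le_norm h.lipschitz (p + r₀ • ν) (y + w)
  have e1 : y + w - (p - r₀ • ν) = (r₀ + b y) • ν + w := by
    nth_rewrite 1 [hpy]; module
  have e2 : p + r₀ • ν - (y + w) = (r₀ - b y) • ν + -w := by
    nth_rewrite 1 [hpy]; module
  rw [e1] at hup
  rw [e2] at hlo
  have n1 := norm_smul_add_le hν (w := w) (ρ := r₀ + b y) (by linarith)
  have n2 := norm_smul_add_le hν (w := -w) (ρ := r₀ - b y) (by linarith)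
  rw [norm_neg, inner_neg_right] at n2
  have a1 := aux (r₀ + b y) (by linarith)
  have a2 := aux (r₀ - b y) (by linarith)
  rw [abs_le]
  constructor <;> linarith

end IsTwoSided

end TwoSided

/-! ### Admissible shapes -/

namespace IsAdmissible

variable {D Ω : Set (Eucl d)} {r₀ : ℝ}

theorem isCompact (h : IsAdmissible D r₀ Ω) (hD : IsCompact D) : IsCompact Ω :=
  hD.of_isClosed_subset h.isClosed h.subset

theorem frontier_subset (h : IsAdmissible D r₀ Ω) : frontier Ω ⊆ D :=
  h.isClosed.frontier_subset.trans h.subset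

theorem nonempty_compl (h : IsAdmissible D r₀ Ω) (hD : IsCompact D) (hd : 0 < d) :
    Ωᶜ.Nonempty := by
  -- Positive dimension makes the space noncompact, so a compact shape cannot fill it.
  have : Nonempty (Fin d) := ⟨⟨0, hd⟩⟩
  rw [Set.nonempty_compl]
  exact (h.isCompact hD).ne_univ

theorem differentiableAt_infDist (h : IsAdmissible D r₀ Ω) {z : Eucl d}
    (hz : 0 < Metric.infDist z (frontier Ω)) (hzr : Metric.infDist z (frontier Ω) < r₀) :
    DifferentiableAt ℝ (fun y => Metric.infDist y (frontier Ω)) z := by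
  have h1 : ENNReal.ofReal (Metric.infDist z (frontier Ω)) < reach (frontier Ω) :=
    lt_of_lt_of_le (by rwa [ENNReal.ofReal_lt_ofReal_iff (hz.trans hzr)]) h.reach_frontier
  obtain ⟨-, ⟨s, ⟨hs, hs'⟩, rfl⟩, hlt⟩ := lt_sSup_iff.1 h1
  rw [ENNReal.ofReal_lt_ofReal_iff hs] at hlt
  exact hs' z ⟨hlt.le, fun hc => hz.ne' (Metric.infDist_zero_of_mem hc)⟩

theorem isTwoSided (h : IsAdmissible D r₀ Ω) (hD : IsCompact D) (hd : 0 < d) (hr₀ : 0 < r₀) :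
    IsTwoSided r₀ (signedDist Ω) (frontier Ω) := by
  have hc := h.nonempty_compl hD hd
  have hne : (frontier Ω).Nonempty :=
    nonempty_frontier_iff.2 ⟨h.nonempty, Set.nonempty_compl.1 hc⟩
  refine isTwoSided_of_differentiableAt
    (hD.of_isClosed_subset isClosed_frontier h.frontier_subset) hne
    (lipschitzWith_signedDist h.nonempty hc) (abs_signedDist h.nonempty hc) hr₀
    (fun z => h.differentiableAt_infDist) ?_ ?_
  · intro x hx
    -- Regularity of `Ω` enters here: without it a frontier point might have no interior points
    -- nearby.
    have hx' : x ∈ closure (interior Ω) := by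
      rw [h.closure_interior]; exact h.isClosed.frontier_subset hx
    refine closure_mono (fun y hy => ?_) hx'
    change signedDist Ω y < 0
    rw [signedDist_of_mem hc (interior_subset hy), neg_lt_zero,
      ← isClosed_frontier.notMem_iff_infDist_pos hne]
    exact fun hy' => hy'.2 hy
  · intro x hx
    rw [frontier_eq_closure_inter_closure] at hx
    refine closure_mono (fun y hy => ?_) hx.2
    change 0 < signedDist Ω y
    rw [signedDist_of_notMem h.nonempty hy, ← isClosed_frontier.notMem_iff_infDist_pos hne]
    exact fun hy' => hy (h.isClosed.frontier_subset hy')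

end IsAdmissible

/-! ### Functions with quadratic Taylor error -/

section QuadApprox

variable {E : Type*} [NormedAddCommGroup E] [NormedSpace ℝ E]

/-- `f` is differentiable on `U`, and its first-order Taylor expansions at points of `U` have an
error of at most `K ‖w‖ ^ 2` on the whole space. -/
def QuadApprox (K : ℝ) (U : Set E) (f : E → ℝ) : Prop :=
  ∀ x ∈ U, DifferentiableAt ℝ f x ∧ ∀ w, |f (x + w) - f x - fderiv ℝ f x w| ≤ K * ‖w‖ ^ 2

theorem hasFDerivAt_of_abs_sub_le {f : E → ℝ} {L : E →L[ℝ] ℝ} {K : ℝ} {x : E}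
    (h : ∀ w, |f (x + w) - f x - L w| ≤ K * ‖w‖ ^ 2) : HasFDerivAt f L x := by
  rw [hasFDerivAt_iff_isLittleO_nhds_zero]
  refine Asymptotics.IsBigO.trans_isLittleO (g := fun w : E => ‖w‖ ^ 2)
    (Asymptotics.IsBigO.of_bound K (Eventually.of_forall fun w => ?_)) ?_
  · simpa using h w
  · exact Asymptotics.isLittleO_norm_pow_id one_lt_two

namespace QuadApprox

variable {K K' : ℝ} {U U' : Set E} {f g : E → ℝ} {x y : E}

theorem of_exists (h : ∀ x ∈ U, ∃ L : E →L[ℝ] ℝ, ∀ w, |f (x + w) - f x - L w| ≤ K * ‖w‖ ^ 2) :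
    QuadApprox K U f := by
  intro x hx
  obtain ⟨L, hL⟩ := h x hx
  have := hasFDerivAt_of_abs_sub_le hL
  exact ⟨this.differentiableAt, by rwa [this.fderiv]⟩

theorem mono (h : QuadApprox K U f) (hU : U' ⊆ U) : QuadApprox K U' f :=
  fun x hx => h x (hU hx)

theorem sub (hf : QuadApprox K U f) (hg : QuadApprox K' U g) :
    QuadApprox (K + K') U fun x => f x - g x := by
  intro x hx
  refine ⟨(hf x hx).1.fun_sub (hg x hx).1, fun w => ?_⟩
  rw [fderiv_fun_sub (hf x hx).1 (hg x hx).1, sub_apply, add_mul]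
  refine le_trans (le_of_eq ?_)
    ((abs_sub _ _).trans (add_le_add ((hf x hx).2 w) ((hg x hx).2 w)))
  congr 1; ring

theorem norm_le_of_unit {L : E →L[ℝ] ℝ} {C δ : ℝ} (hC : 0 ≤ C) (hδ : 0 < δ)
    (h : ∀ w, ‖w‖ = δ → |L w| ≤ C * δ) : ‖L‖ ≤ C := by
  refine L.opNorm_le_of_unit_norm hC fun w hw => ?_
  have := h (δ • w) (by rw [norm_smul, hw, Real.norm_of_nonneg hδ.le, mul_one])
  rw [map_smul, smul_eq_mul, abs_mul, abs_of_pos hδ, mul_comm] at this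
  exact le_of_mul_le_mul_right this hδ

/-- With `δ = ‖x - y‖ = ‖w‖`, expand `f (x + w)` at `x` and at `y`, and `f x` at `y`: the errors
`Kδ²`, `4Kδ²`, `Kδ²` add up to `6Kδ²`. Convexity of `U` is not needed, as the expansions hold for
every increment. -/
theorem norm_fderiv_sub_le (h : QuadApprox K U f) (hK : 0 ≤ K) (hx : x ∈ U) (hy : y ∈ U) :
    ‖fderiv ℝ f x - fderiv ℝ f y‖ ≤ 6 * K * ‖x - y‖ := by
  rcases eq_or_ne x y with rfl | hxy
  · simp
  have hδ : 0 < ‖x - y‖ := norm_pos_iff.2 (sub_ne_zero.2 hxy)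
  refine norm_le_of_unit (by positivity) hδ fun w hw => ?_
  have h1 := (h x hx).2 w
  have h2 := (h y hy).2 (x - y + w)
  have h3 := (h y hy).2 (x - y)
  have h4 : ‖x - y + w‖ ^ 2 ≤ 4 * ‖x - y‖ ^ 2 := by
    have := norm_add_le (x - y) w
    rw [hw] at this
    nlinarith [norm_nonneg (x - y + w)]
  have h5 := mul_le_mul_of_nonneg_left h4 hK
  rw [show y + (x - y + w) = x + w by abel, map_add] at h2
  rw [add_sub_cancel] at h3
  rw [hw] at h1
  rw [sub_apply]
  rw [abs_le] at h1 h2 h3 ⊢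
  constructor <;> nlinarith

/-- Landau-type interpolation: an increment of length `δ` gives `|Df(w)| ≤ 2ε + Kδ²`. -/
theorem norm_fderiv_le (h : QuadApprox K U f) (hK : 0 ≤ K) {ε δ : ℝ} (hδ : 0 < δ)
    (hf : ∀ z, |f z| ≤ ε) (hx : x ∈ U) : ‖fderiv ℝ f x‖ ≤ 2 * ε / δ + K * δ := by
  have hε : 0 ≤ ε := (abs_nonneg _).trans (hf x)
  refine norm_le_of_unit (by positivity) hδ fun w hw => ?_
  have h1 := (h x hx).2 w
  have h2 := hf x
  have h3 := hf (x + w)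
  have e : (2 * ε / δ + K * δ) * δ = 2 * ε + K * δ ^ 2 := by field_simp
  rw [e]
  rw [hw] at h1
  rw [abs_le] at h1 h2 h3 ⊢
  constructor <;> linarith

/-- Uniform convergence upgrades to uniform convergence of the derivatives. -/
theorem eventually_norm_fderiv_sub_le {F : ℕ → E → ℝ} (hK : 0 ≤ K)
    (hF : ∀ᶠ n in atTop, QuadApprox K U (F n)) (hg : QuadApprox K U g)
    (hu : TendstoUniformly F g atTop) {η : ℝ} (hη : 0 < η) :
    ∀ᶠ n in atTop, ∀ x ∈ U, ‖fderiv ℝ (F n) x - fderiv ℝ g x‖ ≤ η := by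
  have hK' : 0 < K + K + 1 := by positivity
  -- The difference has Taylor constant `K + K`; this `δ` makes the quadratic term at most `η / 2`,
  -- and the extra `1` covers `K = 0`.
  set δ := η / (2 * (K + K + 1)) with hδ
  have hδ0 : 0 < δ := by positivity
  have hε : 0 < η * δ / 4 := by positivity
  filter_upwards [hF, Metric.tendstoUniformly_iff.1 hu _ hε] with n hn hn' x hx
  have h := (hn.sub hg).norm_fderiv_le (by positivity) hδ0 (fun z => by
    have := (hn' z).le
    rwa [dist_comm, Real.dist_eq] at this) hx
  rw [fderiv_fun_sub (hn x hx).1 (hg x hx).1] at h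
  refine h.trans ?_
  have e1 : 2 * (η * δ / 4) / δ = η / 2 := by field_simp; norm_num
  have e2 : (K + K) * δ ≤ η / 2 := by
    have : (K + K + 1) * δ = η / 2 := by rw [hδ]; field_simp
    linarith
  linarith

end QuadApprox

end QuadApprox

/-! ### Hölder estimates -/

/-- Interpolation: split the distance as its powers `1 - α` and `α`, bounding the first by `M` and
the second by the Lipschitz estimate. -/
theorem eHolderNorm_le_ofReal {X Y : Type*} [PseudoMetricSpace X] [PseudoMetricSpace Y]
    {f : X → Y} {α : ℝ≥0} (hα : α ≤ 1) {M L : ℝ} (hM : 0 ≤ M) (hL : 0 ≤ L)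
    (h1 : ∀ x y, dist (f x) (f y) ≤ M) (h2 : ∀ x y, dist (f x) (f y) ≤ L * dist x y) :
    eHolderNorm α f ≤ ENNReal.ofReal (M ^ (1 - α : ℝ) * L ^ (α : ℝ)) := by
  have hα' : (0 : ℝ) ≤ 1 - α := sub_nonneg.2 (by exact_mod_cast hα)
  refine HolderWith.eHolderNorm_le fun x y => ?_
  have hC : 0 ≤ M ^ (1 - α : ℝ) * L ^ (α : ℝ) := by positivity
  rw [edist_dist, edist_dist, ENNReal.ofReal_rpow_of_nonneg dist_nonneg α.coe_nonneg,
    ← ENNReal.ofReal.eq_1, ← ENNReal.ofReal_mul hC]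
  apply ENNReal.ofReal_le_ofReal
  calc dist (f x) (f y) = dist (f x) (f y) ^ (1 - α : ℝ) * dist (f x) (f y) ^ (α : ℝ) := by
        rw [← Real.rpow_add' dist_nonneg (by simp), sub_add_cancel, Real.rpow_one]
    _ ≤ M ^ (1 - α : ℝ) * (L * dist x y) ^ (α : ℝ) := by
        gcongr
        · exact h1 x y
        · exact h2 x y
    _ = M ^ (1 - α : ℝ) * L ^ (α : ℝ) * dist x y ^ (α : ℝ) := by
        rw [Real.mul_rpow hL dist_nonneg, mul_assoc]

theorem c1HolderNorm_le {α : ℝ≥0} (hα : α ≤ 1) {U : Set (Eucl d)} {f : Eucl d → ℝ} {R M L : ℝ}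
    (hM : 0 ≤ M) (hL : 0 ≤ L) (h0 : ∀ x ∈ U, |f x| ≤ R) (h1 : ∀ x ∈ U, ‖fderiv ℝ f x‖ ≤ M)
    (h2 : ∀ x ∈ U, ∀ y ∈ U, ‖fderiv ℝ f x - fderiv ℝ f y‖ ≤ L * ‖x - y‖) :
    c1HolderNorm α U f ≤
      ENNReal.ofReal R + ENNReal.ofReal M +
        ENNReal.ofReal ((2 * M) ^ (1 - α : ℝ) * L ^ (α : ℝ)) := by
  refine add_le_add (add_le_add (iSup₂_le fun x hx => ?_) (iSup₂_le fun x hx => ?_)) ?_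
  · rw [← ofReal_norm, Real.norm_eq_abs]
    exact ENNReal.ofReal_le_ofReal (h0 x hx)
  · rw [← ofReal_norm]
    exact ENNReal.ofReal_le_ofReal (h1 x hx)
  · refine eHolderNorm_le_ofReal hα (by positivity) hL (fun x y => ?_) fun x y => ?_
    · rw [dist_eq_norm]
      refine (norm_sub_le _ _).trans ?_
      have := h1 x x.2
      have := h1 y y.2
      simp only [domRestrict_apply]
      linarith
    · rw [dist_eq_norm, Subtype.dist_eq, dist_eq_norm]
      exact h2 x x.2 y y.2

theorem LipschitzWith.norm_fderiv_le_one {E : Type*} [NormedAddCommGroup E] [NormedSpace ℝ E]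
    {f : E → ℝ} (hf : LipschitzWith 1 f) (x : E) : ‖fderiv ℝ f x‖ ≤ 1 := by
  simpa using norm_fderiv_le_of_lipschitz ℝ hf (x₀ := x)

section Convergence

variable {K R : ℝ} {U : Set (Eucl d)} {f : Eucl d → ℝ} {α : ℝ≥0}

theorem QuadApprox.memC1Holder (h : QuadApprox K U f) (hK : 0 ≤ K) (hf : LipschitzWith 1 f)
    (hR : ∀ x ∈ U, |f x| ≤ R) (hα : α ≤ 1) : MemC1Holder α U f := by
  have hlip : ∀ x ∈ U, ∀ y ∈ U, ‖fderiv ℝ f x - fderiv ℝ f y‖ ≤ 6 * K * ‖x - y‖ :=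
    fun x hx y hy => h.norm_fderiv_sub_le hK hx hy
  refine ⟨fun x hx => (h x hx).1, ?_, ?_⟩
  · refine (LipschitzOnWith.of_dist_le_mul (K := Real.toNNReal (6 * K))
      fun x hx y hy => ?_).continuousOn
    rw [dist_eq_norm, dist_eq_norm, Real.coe_toNNReal _ (by positivity)]
    exact hlip x hx y hy
  · refine (c1HolderNorm_le hα zero_le_one (by positivity) hR
      (fun x _ => LipschitzWith.norm_fderiv_le_one hf x) hlip).trans_lt ?_
    simp [ENNReal.add_lt_top]

theorem tendstoC1Holder_of_tendstoUniformly {F : ℕ → Eucl d → ℝ} (hK : 0 ≤ K)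
    (hF : ∀ᶠ n in atTop, QuadApprox K U (F n)) (hf : QuadApprox K U f)
    (hFl : ∀ n, LipschitzWith 1 (F n)) (hfl : LipschitzWith 1 f)
    (hu : TendstoUniformly F f atTop) (hR : ∀ x ∈ U, |f x| ≤ R) (hα : α < 1) :
    TendstoC1Holder α U F f := by
  have hclose (η : ℝ) (hη : 0 < η) : ∀ᶠ n in atTop, ∀ x, |F n x - f x| ≤ η := by
    filter_upwards [Metric.tendstoUniformly_iff.1 hu η hη] with n hn x
    have := (hn x).le
    rwa [dist_comm, Real.dist_eq] at this
  refine ⟨?_, hf.memC1Holder hK hfl hR hα.le, ?_⟩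
  · filter_upwards [hF, hclose 1 one_pos] with n hn hn'
    refine hn.memC1Holder hK (hFl n) (R := R + 1) (fun x hx => ?_) hα.le
    have h1 := hn' x
    have h2 := hR x hx
    rw [abs_le] at h1 h2 ⊢
    constructor <;> linarith
  -- Strictness is essential: the Hölder seminorm of the difference is small only through the factor
  -- `(2η) ^ (1 - α)`.
  · have hα' : (0 : ℝ) < 1 - α := sub_pos.2 (by exact_mod_cast hα)
    have hlim : Tendsto (fun η : ℝ => ENNReal.ofReal η + ENNReal.ofReal η +
        ENNReal.ofReal ((2 * η) ^ (1 - α : ℝ) * (6 * (K + K)) ^ (α : ℝ))) (𝓝[>] 0) (𝓝 0) := by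
      have hc : Continuous (fun η : ℝ => ENNReal.ofReal η + ENNReal.ofReal η +
          ENNReal.ofReal ((2 * η) ^ (1 - α : ℝ) * (6 * (K + K)) ^ (α : ℝ))) := by
        have : Continuous fun η : ℝ => (2 * η) ^ (1 - α : ℝ) :=
          (continuous_const.mul continuous_id).rpow_const fun _ => Or.inr hα'.le
        exact (ENNReal.continuous_ofReal.add ENNReal.continuous_ofReal).add
          (ENNReal.continuous_ofReal.comp (this.mul continuous_const))
      have := hc.tendsto 0
      simp only [ENNReal.ofReal_zero, mul_zero, Real.zero_rpow hα'.ne', zero_mul, add_zero] at this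
      exact this.mono_left nhdsWithin_le_nhds
    rw [ENNReal.tendsto_nhds_zero]
    intro e he
    obtain ⟨η, hηe, hη⟩ := ((ENNReal.tendsto_nhds_zero.1 hlim e he).and
      self_mem_nhdsWithin).exists
    have hη : 0 < η := hη
    filter_upwards [hF, hclose η hη, QuadApprox.eventually_norm_fderiv_sub_le hK hF hf hu hη]
      with n hn hn' hn''
    refine (c1HolderNorm_le hα.le hη.le (L := 6 * (K + K)) (by positivity) (fun x _ => hn' x)
      (fun x hx => ?_) fun x hx y hy => ?_).trans hηe
    · rw [fderiv_fun_sub (hn x hx).1 (hf x hx).1]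
      exact hn'' x hx
    · exact (hn.sub hf).norm_fderiv_sub_le (by positivity) hx hy

end Convergence

/-! ### Lipschitz extension -/

section LipExt

variable {X : Type*} [PseudoMetricSpace X] {L : ℝ≥0} {U : Set X} {f g : X → ℝ}

/-- The largest `L`-Lipschitz extension of an `L`-Lipschitz function on `U`. -/
def lipExt (L : ℝ≥0) (U : Set X) (f : X → ℝ) (x : X) : ℝ :=
  ⨅ y : U, f y + L * dist x y

theorem bddBelow_lipExt (hf : LipschitzOnWith L f U) (hU : U.Nonempty) (x : X) :
    BddBelow (range fun y : U => f y + L * dist x y) := by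
  obtain ⟨y₀, hy₀⟩ := hU
  refine ⟨f y₀ - L * dist x y₀, ?_⟩
  rintro - ⟨y, rfl⟩
  have h1 := hf.dist_le_mul y₀ hy₀ y y.2
  rw [Real.dist_eq] at h1
  have h2 := mul_le_mul_of_nonneg_left (dist_triangle_left y₀ (y : X) x) L.coe_nonneg
  have h3 := le_abs_self (f y₀ - f y)
  simp only
  linarith

theorem lipExt_eq (hf : LipschitzOnWith L f U) {x : X} (hx : x ∈ U) : lipExt L U f x = f x := by
  have : Nonempty U := ⟨⟨x, hx⟩⟩
  apply le_antisymm
  · have h : lipExt L U f x ≤ f x + L * dist x x :=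
      ciInf_le (bddBelow_lipExt hf ⟨x, hx⟩ x) ⟨x, hx⟩
    simpa using h
  · refine le_ciInf fun y => ?_
    have h1 := hf.dist_le_mul x hx y y.2
    rw [Real.dist_eq] at h1
    linarith [le_abs_self (f x - f y)]

theorem lipschitzWith_lipExt (hf : LipschitzOnWith L f U) (hU : U.Nonempty) :
    LipschitzWith L (lipExt L U f) := by
  have : Nonempty U := hU.to_subtype
  refine LipschitzWith.of_le_add_mul L fun x y => ?_
  rw [← sub_le_iff_le_add]
  refine le_ciInf fun z => ?_
  have h1 : lipExt L U f x ≤ f z + L * dist x z := ciInf_le (bddBelow_lipExt hf hU x) z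
  have h2 := mul_le_mul_of_nonneg_left (dist_triangle x y z) L.coe_nonneg
  linarith

/-- The infimum formula is monotone and commutes with adding constants, so uniform closeness on `U`
extends to the whole space. -/
theorem lipExt_le_add (hf : LipschitzOnWith L f U) (hU : U.Nonempty) {ε : ℝ}
    (h : ∀ y ∈ U, f y ≤ g y + ε) (x : X) : lipExt L U f x ≤ lipExt L U g x + ε := by
  have : Nonempty U := hU.to_subtype
  rw [← sub_le_iff_le_add]
  refine le_ciInf fun z => ?_
  have h1 : lipExt L U f x ≤ f z + L * dist x z := ciInf_le (bddBelow_lipExt hf hU x) z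
  linarith [h z z.2]

theorem tendstoUniformly_lipExt {F : ℕ → X → ℝ} (hF : ∀ᶠ n in atTop, LipschitzOnWith L (F n) U)
    (hf : LipschitzOnWith L f U) (hU : U.Nonempty)
    (h : ∀ ε > 0, ∀ᶠ n in atTop, ∀ x ∈ U, |F n x - f x| ≤ ε) :
    TendstoUniformly (fun n => lipExt L U (F n)) (lipExt L U f) atTop := by
  rw [Metric.tendstoUniformly_iff]
  intro ε hε
  filter_upwards [hF, h (ε / 2) (by positivity)] with n hn hn' x
  have h1 := lipExt_le_add (ε := ε / 2) (g := f) hn hU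
    (fun y hy => by linarith [(abs_le.1 (hn' y hy)).2]) x
  have h2 := lipExt_le_add (ε := ε / 2) (g := F n) hf hU
    (fun y hy => by linarith [(abs_le.1 (hn' y hy)).1]) x
  rw [Real.dist_eq, abs_lt]
  constructor <;> linarith

end LipExt

/-! ### Weak convergence of derivatives of Lipschitz functions -/

section Weak

theorem tendsto_integral_mul_of_tendstoUniformlyOn {Ω : Type*} [MeasurableSpace Ω] {μ : Measure Ω}
    {V : Set Ω} (hV : ∀ᵐ x ∂μ, x ∈ V) {F : ℕ → Ω → ℝ} {f ψ : Ω → ℝ}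
    (hF : ∀ᶠ n in atTop, AEStronglyMeasurable (F n) μ) (hψ : Integrable ψ μ)
    (hfψ : Integrable (fun x => f x * ψ x) μ) (hu : TendstoUniformlyOn F f atTop V) :
    Tendsto (fun n => ∫ x, F n x * ψ x ∂μ) atTop (𝓝 (∫ x, f x * ψ x ∂μ)) := by
  refine tendsto_integral_filter_of_dominated_convergence (fun x => ‖f x * ψ x‖ + ‖ψ x‖) ?_ ?_
    (hfψ.norm.add hψ.norm) ?_
  · filter_upwards [hF] with n hn using hn.mul hψ.aestronglyMeasurable
  · filter_upwards [Metric.tendstoUniformlyOn_iff.1 hu 1 one_pos] with n hn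
    filter_upwards [hV] with x hx
    have h := (hn x hx).le
    rw [dist_comm, Real.dist_eq] at h
    have e : F n x * ψ x = f x * ψ x + (F n x - f x) * ψ x := by ring
    rw [e]
    refine (norm_add_le _ _).trans (add_le_add le_rfl ?_)
    rw [norm_mul, Real.norm_eq_abs (F n x - f x)]
    exact mul_le_of_le_one_left (norm_nonneg _) h
  · filter_upwards [hV] with x hx
    exact (hu.tendsto_at hx).mul_const _

variable {E : Type*} [NormedAddCommGroup E] [NormedSpace ℝ E] [MeasurableSpace E]
  {μ : Measure E} {L : ℝ≥0}

theorem abs_integral_lineDeriv_mul_le {F ψ : E → ℝ} (hF : LipschitzWith L F) (v : E)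
    (hψ : Integrable ψ μ) :
    |∫ x, lineDeriv ℝ F x v * ψ x ∂μ| ≤ L * ‖v‖ * ∫ x, ‖ψ x‖ ∂μ := by
  rw [← integral_const_mul, ← Real.norm_eq_abs]
  refine norm_integral_le_of_norm_le (hψ.norm.const_mul _) (Eventually.of_forall fun x => ?_)
  rw [norm_mul]
  gcongr
  exact norm_lineDeriv_le_of_lipschitz ℝ hF

theorem integrable_lineDeriv_mul [BorelSpace E] {F ψ : E → ℝ} (hF : LipschitzWith L F) (v : E)
    (hψ : Integrable ψ μ) : Integrable (fun x => lineDeriv ℝ F x v * ψ x) μ :=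
  hψ.bdd_mul (c := L * ‖v‖) (aestronglyMeasurable_lineDeriv hF.continuous μ)
    (Eventually.of_forall fun _ => norm_lineDeriv_le_of_lipschitz ℝ hF)

/-- For smooth compactly supported tests, integration by parts moves the derivative off `F n`.
General `ψ` follow by density in `L¹` and the common bound `L * ‖v‖` on the derivatives. -/
theorem tendsto_integral_lineDeriv_mul [FiniteDimensional ℝ E] [BorelSpace E]
    [μ.IsAddHaarMeasure] {F : ℕ → E → ℝ} {f : E → ℝ}
    (hF : ∀ᶠ n in atTop, LipschitzWith L (F n)) (hf : LipschitzWith L f)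
    (hu : TendstoUniformly F f atTop) (v : E) {ψ : E → ℝ} (hψ : Integrable ψ μ) :
    Tendsto (fun n => ∫ x, lineDeriv ℝ (F n) x v * ψ x ∂μ) atTop
      (𝓝 (∫ x, lineDeriv ℝ f x v * ψ x ∂μ)) := by
  have hsmooth : ∀ g : E → ℝ, HasCompactSupport g → ContDiff ℝ ∞ g →
      Tendsto (fun n => ∫ x, lineDeriv ℝ (F n) x v * g x ∂μ) atTop
        (𝓝 (∫ x, lineDeriv ℝ f x v * g x ∂μ)) := by
    intro g hg hg'
    obtain ⟨C, hC⟩ := (hg'.of_le (m := 1) (by simp)).lipschitzWith_of_hasCompactSupport hg (by simp)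
    have hline : (fun x => lineDeriv ℝ g x (-v)) = fun x => fderiv ℝ g x (-v) := by
      ext x
      exact (hg'.differentiable (by simp) x).lineDeriv_eq_fderiv
    have hcont : Continuous fun x => fderiv ℝ g x (-v) :=
      (hg'.continuous_fderiv (by simp)).clm_apply continuous_const
    have hsupp : HasCompactSupport fun x => fderiv ℝ g x (-v) := hg.fderiv_apply ℝ (-v)
    have hint (h : E → ℝ) (hh : LipschitzWith L h) :
        ∫ x, lineDeriv ℝ h x v * g x ∂μ = ∫ x, h x * fderiv ℝ g x (-v) ∂μ := by
      rw [hh.integral_lineDeriv_mul_eq hC hg]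
      refine integral_congr_ae (Eventually.of_forall fun x => ?_)
      simp only [congrFun hline x, mul_comm]
    rw [hint f hf]
    refine Tendsto.congr' ?_ (tendsto_integral_mul_of_tendstoUniformlyOn (V := univ) (μ := μ)
      (F := F) (f := f) (ψ := fun x => fderiv ℝ g x (-v)) (by simp) ?_
      (hcont.integrable_of_hasCompactSupport hsupp) ?_ (tendstoUniformlyOn_univ.2 hu))
    · filter_upwards [hF] with n hn using (hint (F n) hn).symm
    · filter_upwards [hF] with n hn using hn.continuous.aestronglyMeasurable
    · exact (hf.continuous.mul hcont).integrable_of_hasCompactSupport hsupp.mul_left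
  rw [Metric.tendsto_atTop']
  intro ε hε
  set C : ℝ := L * ‖v‖ + 1 with hC
  have hC0 : 0 < C := by positivity
  obtain ⟨g, hg, hg', hgψ⟩ := (memLp_one_iff_integrable.2 hψ).exist_eLpNorm_sub_le (by simp)
    le_rfl (show 0 < ε / (4 * C) by positivity)
  have hgi : Integrable g μ := hg'.continuous.integrable_of_hasCompactSupport hg
  have hsub : Integrable (fun x => ψ x - g x) μ := hψ.sub hgi
  have hnorm : ∫ x, ‖ψ x - g x‖ ∂μ ≤ ε / (4 * C) := by
    rw [integral_norm_eq_lintegral_enorm hsub.aestronglyMeasurable]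
    refine ENNReal.toReal_le_of_le_ofReal (by positivity) ?_
    simpa [eLpNorm_one_eq_lintegral_enorm] using hgψ
  have hclose (h : E → ℝ) (hh : LipschitzWith L h) :
      |∫ x, lineDeriv ℝ h x v * ψ x ∂μ - ∫ x, lineDeriv ℝ h x v * g x ∂μ| ≤ ε / 4 := by
    rw [← integral_sub (integrable_lineDeriv_mul hh v hψ) (integrable_lineDeriv_mul hh v hgi)]
    simp_rw [← mul_sub]
    refine (abs_integral_lineDeriv_mul_le hh v hsub).trans ?_
    calc L * ‖v‖ * ∫ x, ‖ψ x - g x‖ ∂μ ≤ C * (ε / (4 * C)) := by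
          gcongr
          rw [hC]; linarith
      _ = ε / 4 := by field_simp
  have hev : ∀ᶠ n in atTop, dist (∫ x, lineDeriv ℝ (F n) x v * ψ x ∂μ)
      (∫ x, lineDeriv ℝ f x v * ψ x ∂μ) < ε := by
    filter_upwards [hF, Metric.tendsto_nhds.1 (hsmooth g hg hg') (ε / 4) (by positivity)]
      with n hn hn'
    have h1 := hclose (F n) hn
    have h2 := hclose f hf
    rw [Real.dist_eq] at hn' ⊢
    rw [abs_le] at h1 h2
    rw [abs_lt] at hn' ⊢
    constructor <;> linarith
  obtain ⟨N, hN⟩ := eventually_atTop.1 hev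
  exact ⟨N, fun n hn => hN n hn.le⟩

end Weak

/-! ### Weak-star convergence in `W^{2,∞}` -/

section W2Inf

variable {V U : Set (Eucl d)}

/-- Integration by parts is done on the whole space, hence the global Lipschitz hypothesis; the test
function vanishes off `V`, so only values of `g` on `V` matter. -/
theorem IsWeakPartial.of_lipschitz {L : ℝ≥0} {f g : Eucl d → ℝ} (hf : LipschitzWith L f)
    (i : Fin d) (hg : ∀ x ∈ V, lineDeriv ℝ f x (EuclideanSpace.single i 1) = g x) :
    IsWeakPartial V i f g := by
  intro φ hφ hφc hφV
  obtain ⟨C, hC⟩ := (hφ.of_le (m := 1) (by simp)).lipschitzWith_of_hasCompactSupport hφc (by simp)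
  have hline (v x : Eucl d) : lineDeriv ℝ φ x v = fderiv ℝ φ x v :=
    (hφ.differentiable (by simp) x).lineDeriv_eq_fderiv
  have h0 : ∀ x, x ∉ V → φ x = 0 := fun x hx =>
    image_eq_zero_of_notMem_tsupport fun h => hx (hφV h)
  have h1 : ∀ x, x ∉ V → fderiv ℝ φ x = 0 := fun x hx =>
    image_eq_zero_of_notMem_tsupport fun h => hx (hφV (tsupport_fderiv_subset ℝ h))
  rw [setIntegral_eq_integral_of_forall_compl_eq_zero fun x hx => by simp [h1 x hx],
    setIntegral_eq_integral_of_forall_compl_eq_zero fun x hx => by simp [h0 x hx]]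
  have h := hf.integral_lineDeriv_mul_eq (μ := volume) hC hφc (EuclideanSpace.single i 1)
  have e1 : ∫ x, g x * φ x =
      ∫ x, lineDeriv ℝ f x (EuclideanSpace.single i 1) * φ x := by
    congr 1 with x
    by_cases hx : x ∈ V
    · rw [hg x hx]
    · simp [h0 x hx]
  rw [e1, h, ← integral_neg]
  congr 1 with x
  rw [hline, map_neg]
  ring

theorem MemLInf.of_bound (hV : MeasurableSet V) {f : Eucl d → ℝ} (hf : Continuous f) {C : ℝ}
    (h : ∀ x ∈ V, |f x| ≤ C) : MemLInf V f :=
  memLp_top_of_bound hf.aestronglyMeasurable C (ae_restrict_of_forall_mem hV h)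

theorem TendstoWeakStarLInf.of_tendstoUniformlyOn (hV : MeasurableSet V)
    {F : ℕ → Eucl d → ℝ} {f : Eucl d → ℝ} (hF : ∀ᶠ n in atTop, Continuous (F n))
    (hf : Continuous f) {C : ℝ} (hfC : ∀ x ∈ V, |f x| ≤ C) (hu : TendstoUniformlyOn F f atTop V) :
    TendstoWeakStarLInf V F f := by
  intro ψ hψ
  refine tendsto_integral_mul_of_tendstoUniformlyOn (ae_restrict_mem hV) ?_ hψ ?_ hu
  · filter_upwards [hF] with n hn using hn.aestronglyMeasurable
  · exact hψ.bdd_mul (c := C) hf.aestronglyMeasurable (ae_restrict_of_forall_mem hV hfC)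

variable {K R : ℝ} {f : Eucl d → ℝ}

/-- The partial derivative `∂_i f` on `U`, extended to a globally Lipschitz function. -/
def partialExt (K : ℝ) (U : Set (Eucl d)) (f : Eucl d → ℝ) (i : Fin d) : Eucl d → ℝ :=
  lipExt (Real.toNNReal (6 * K)) U fun x => fderiv ℝ f x (EuclideanSpace.single i 1)

theorem QuadApprox.lipschitzOnWith_partial (h : QuadApprox K U f) (hK : 0 ≤ K) (i : Fin d) :
    LipschitzOnWith (Real.toNNReal (6 * K))
      (fun x => fderiv ℝ f x (EuclideanSpace.single i 1)) U := by
  refine LipschitzOnWith.of_dist_le_mul fun x hx y hy => ?_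
  rw [dist_eq_norm, dist_eq_norm, Real.coe_toNNReal _ (by positivity), ← sub_apply]
  refine ((fderiv ℝ f x - fderiv ℝ f y).le_of_opNorm_le
    (h.norm_fderiv_sub_le hK hx hy) _).trans ?_
  simp

/-- The gradient is Lipschitz only on `U`, so its components are extended first. The line
derivatives of the extensions, bounded by the Lipschitz constant, serve as second derivatives. -/
theorem QuadApprox.isW2Inf (h : QuadApprox K U f) (hK : 0 ≤ K) (hU : U.Nonempty)
    (hf : LipschitzWith 1 f) (hR : ∀ x ∈ U, |f x| ≤ R) (hV : IsOpen V) (hVU : V ⊆ U) :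
    IsW2Inf V f (partialExt K U f)
      (fun i j x => lineDeriv ℝ (partialExt K U f i) x (EuclideanSpace.single j 1)) := by
  have hlip (i : Fin d) : LipschitzWith (Real.toNNReal (6 * K)) (partialExt K U f i) :=
    lipschitzWith_lipExt (h.lipschitzOnWith_partial hK i) hU
  have heq (i : Fin d) (x : Eucl d) (hx : x ∈ U) :
      partialExt K U f i x = fderiv ℝ f x (EuclideanSpace.single i 1) :=
    lipExt_eq (h.lipschitzOnWith_partial hK i) hx
  refine ⟨.of_bound hV.measurableSet hf.continuous fun x hx => hR x (hVU hx), fun i =>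
    .of_bound (C := 1) hV.measurableSet (hlip i).continuous fun x hx => ?_, fun i j => ?_,
    fun i => .of_lipschitz hf i fun x hx => ?_, fun i j => .of_lipschitz (hlip i) j fun x _ => rfl⟩
  · rw [heq i x (hVU hx), ← Real.norm_eq_abs]
    simpa using (fderiv ℝ f x).le_of_opNorm_le (LipschitzWith.norm_fderiv_le_one hf x)
      (EuclideanSpace.single i 1)
  · exact ((hlip i).memLp_lineDeriv _).restrict V
  · rw [heq i x (hVU hx), (h x (hVU hx)).1.lineDeriv_eq_fderiv]

theorem tendstoWeakStarW2Inf_of_tendstoUniformly {F : ℕ → Eucl d → ℝ} (hK : 0 ≤ K)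
    (hF : ∀ᶠ n in atTop, QuadApprox K U (F n)) (hf : QuadApprox K U f)
    (hFl : ∀ n, LipschitzWith 1 (F n)) (hfl : LipschitzWith 1 f)
    (hu : TendstoUniformly F f atTop) (hR : ∀ x ∈ U, |f x| ≤ R) (hU : U.Nonempty)
    (hV : IsOpen V) (hVU : V ⊆ U) : TendstoWeakStarW2Inf V F f := by
  have hlip (i : Fin d) : LipschitzWith (Real.toNNReal (6 * K)) (partialExt K U f i) :=
    lipschitzWith_lipExt (hf.lipschitzOnWith_partial hK i) hU
  have hFlip (i : Fin d) : ∀ᶠ n in atTop,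
      LipschitzWith (Real.toNNReal (6 * K)) (partialExt K U (F n) i) := by
    filter_upwards [hF] with n hn using lipschitzWith_lipExt (hn.lipschitzOnWith_partial hK i) hU
  have hunif (i : Fin d) : TendstoUniformly (fun n => partialExt K U (F n) i)
      (partialExt K U f i) atTop := by
    refine tendstoUniformly_lipExt ?_ (hf.lipschitzOnWith_partial hK i) hU fun ε hε => ?_
    · filter_upwards [hF] with n hn using hn.lipschitzOnWith_partial hK i
    · filter_upwards [QuadApprox.eventually_norm_fderiv_sub_le hK hF hf hu hε] with n hn x hx
      rw [← sub_apply, ← Real.norm_eq_abs]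
      simpa using (fderiv ℝ (F n) x - fderiv ℝ f x).le_of_opNorm_le (hn x hx)
        (EuclideanSpace.single i 1)
  have hW := hf.isW2Inf hK hU hfl hR hV hVU
  refine ⟨fun n => partialExt K U (F n),
    fun n i j x => lineDeriv ℝ (partialExt K U (F n) i) x (EuclideanSpace.single j 1),
    partialExt K U f,
    fun i j x => lineDeriv ℝ (partialExt K U f i) x (EuclideanSpace.single j 1), ?_, hW, ?_, ?_, ?_⟩
  · filter_upwards [hF, Metric.tendstoUniformly_iff.1 hu 1 one_pos] with n hn hn'
    refine hn.isW2Inf hK hU (hFl n) (R := R + 1) (fun x hx => ?_) hV hVU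
    have h1 := (hn' x).le
    have h2 := hR x hx
    rw [Real.dist_eq] at h1
    rw [abs_le] at h1 h2 ⊢
    constructor <;> linarith
  · exact .of_tendstoUniformlyOn hV.measurableSet (Eventually.of_forall fun n => (hFl n).continuous)
      hfl.continuous (fun x hx => hR x (hVU hx)) hu.tendstoUniformlyOn
  · intro i
    refine .of_tendstoUniformlyOn (C := 1) hV.measurableSet
      ((hFlip i).mono fun n hn => hn.continuous) (hlip i).continuous (fun x hx => ?_)
      (hunif i).tendstoUniformlyOn
    rw [partialExt, lipExt_eq (hf.lipschitzOnWith_partial hK i) (hVU hx), ← Real.norm_eq_abs]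
    simpa using (fderiv ℝ f x).le_of_opNorm_le (LipschitzWith.norm_fderiv_le_one hfl x)
      (EuclideanSpace.single i 1)
  · intro i j ψ hψ
    have h := tendsto_integral_lineDeriv_mul (μ := volume) (hFlip i) (hlip i) (hunif i)
      (EuclideanSpace.single j 1) ((integrable_indicator_iff hV.measurableSet).2 hψ)
    have e (h : Eucl d → ℝ) : ∫ x in V, h x * ψ x = ∫ x, h x * V.indicator ψ x := by
      rw [← integral_indicator hV.measurableSet]
      congr 1 with x
      by_cases hx : x ∈ V <;> simp [hx]
    simpa only [e] using h

end W2Inf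

/-! ### Two-sided sets are admissible shapes -/

section Null

variable {E : Type*} [NormedAddCommGroup E] [InnerProductSpace ℝ E] [FiniteDimensional ℝ E]
  [MeasurableSpace E] [BorelSpace E] {μ : Measure E} [μ.IsAddHaarMeasure] {S : Set E}

/-- A closed set with arbitrarily small exterior tangent balls at each of its points is null. -/
theorem measure_eq_zero_of_tangent_ball (hS : IsClosed S) {r₀ : ℝ} (hr₀ : 0 < r₀)
    (h : ∀ x ∈ S, ∃ ν : E, ‖ν‖ = 1 ∧ ∀ t, 0 < t → t < r₀ →
      Disjoint S (Metric.ball (x + t • ν) t)) : μ S = 0 := by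
  have hae := Besicovitch.ae_tendsto_measure_inter_div_of_measurableSet μ hS.measurableSet
  refine measure_mono_null (fun x hx => ?_) (ae_iff.1 hae)
  intro hlim
  obtain ⟨ν, hν, hdisj⟩ := h x hx
  have : Nontrivial E := ⟨ν, 0, fun h0 => by simp [h0] at hν⟩
  rw [indicator_of_mem hx, Pi.one_apply] at hlim
  set n := Module.finrank ℝ E
  -- A tangent ball of radius `r / 2` inside the ball of radius `r` caps the density of `S` at `1 -
  -- 2⁻ⁿ`, against Lebesgue density one.
  have hbound : ∀ᶠ r in 𝓝[>] (0 : ℝ), μ (S ∩ Metric.closedBall x r) / μ (Metric.closedBall x r) ≤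
      1 - ENNReal.ofReal ((1 / 2) ^ n) := by
    filter_upwards [Ioo_mem_nhdsGT hr₀] with r hr
    have hr0 : 0 < r := hr.1
    have hsub : Metric.ball (x + (r / 2) • ν) (r / 2) ⊆ Metric.closedBall x r := by
      refine (Metric.ball_subset_closedBall.trans (Metric.closedBall_subset_closedBall' ?_))
      simp [dist_eq_norm, norm_smul, hν, abs_of_pos hr0]
    have hle : μ (S ∩ Metric.closedBall x r) ≤
        μ (Metric.closedBall x r) - μ (Metric.ball (x + (r / 2) • ν) (r / 2)) := by
      rw [← measure_sdiff hsub measurableSet_ball.nullMeasurableSet measure_ball_lt_top.ne]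
      refine measure_mono fun y hy => ⟨hy.2, fun hy' => ?_⟩
      exact (hdisj (r / 2) (by positivity) (by linarith [hr.2])).le_bot ⟨hy.1, hy'⟩
    have hB : μ (Metric.closedBall x r) ≠ ⊤ := measure_closedBall_lt_top.ne
    have hB0 : μ (Metric.closedBall x r) ≠ 0 := (Metric.measure_closedBall_pos μ x hr0).ne'
    refine (ENNReal.div_le_div_right hle _).trans ?_
    rw [ENNReal.sub_div (fun _ _ => hB0), ENNReal.div_self hB0 hB]
    gcongr
    rw [ENNReal.le_div_iff_mul_le (Or.inl hB0) (Or.inl hB), Measure.addHaar_closedBall μ x hr0.le,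
      Measure.addHaar_ball μ (x + (r / 2) • ν) (by positivity), ← mul_assoc,
      ← ENNReal.ofReal_mul (by positivity), ← mul_pow, one_div_mul_eq_div]
  have h1 := le_of_tendsto hlim hbound
  have h2 : (1 : ℝ≥0∞) - ENNReal.ofReal ((1 / 2) ^ n) < 1 :=
    ENNReal.sub_lt_self (by simp) (by simp) (by simp)
  exact absurd h1 h2.not_ge

end Null

section Construction

variable {b : Eucl d → ℝ} {Γ D : Set (Eucl d)} {r₀ : ℝ}

namespace IsTwoSided

theorem eq_zero_iff (h : IsTwoSided r₀ b Γ) (x : Eucl d) : b x = 0 ↔ x ∈ Γ := by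
  rw [h.isCompact.isClosed.mem_iff_infDist_zero h.nonempty, ← h.abs_eq, abs_eq_zero]

/-- A 1-Lipschitz function rising from `0` to at least `r₀` over length `r₀` must grow at unit
speed. -/
theorem apply_add_smul (h : IsTwoSided r₀ b Γ) {x ν : Eucl d} (hx : x ∈ Γ) (hν : ‖ν‖ = 1)
    (h1 : r₀ ≤ b (x + r₀ • ν)) {t : ℝ} (ht : 0 ≤ t) (htr : t ≤ r₀) : b (x + t • ν) = t := by
  have hx0 := (h.eq_zero_iff x).2 hx
  have e1 := LipschitzWith.sub_le_norm h.lipschitz (x + t • ν) x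
  have e2 := LipschitzWith.sub_le_norm h.lipschitz (x + r₀ • ν) (x + t • ν)
  rw [add_sub_cancel_left, norm_smul, hν, Real.norm_of_nonneg ht] at e1
  rw [add_sub_add_left_eq_sub, ← sub_smul, norm_smul, hν, Real.norm_of_nonneg (by linarith)] at e2
  linarith

theorem neg (h : IsTwoSided r₀ b Γ) : IsTwoSided r₀ (fun x => -b x) Γ where
  isCompact := h.isCompact
  nonempty := h.nonempty
  lipschitz := h.lipschitz.neg
  abs_eq x := by rw [abs_neg, h.abs_eq]
  exists_normal x hx := by
    obtain ⟨ν, hν, h1, h2⟩ := h.exists_normal x hx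
    refine ⟨-ν, by rwa [norm_neg], ?_, ?_⟩
    · rw [smul_neg, ← sub_eq_add_neg]; linarith
    · rw [smul_neg, sub_neg_eq_add]; linarith

theorem subset_closure_pos (h : IsTwoSided r₀ b Γ) (hr₀ : 0 < r₀) :
    Γ ⊆ closure {x | 0 < b x} := by
  intro x hx
  obtain ⟨ν, hν, h1, -⟩ := h.exists_normal x hx
  have hlim : Tendsto (fun t : ℝ => x + t • ν) (𝓝[>] 0) (𝓝 x) := by
    have : Continuous fun t : ℝ => x + t • ν := by fun_prop
    simpa using (this.tendsto 0).mono_left nhdsWithin_le_nhds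
  refine mem_closure_of_tendsto hlim ?_
  filter_upwards [Ioo_mem_nhdsGT hr₀] with t ht
  rw [h.apply_add_smul hx hν h1 ht.1.le ht.2.le]
  exact ht.1

theorem subset_closure_neg (h : IsTwoSided r₀ b Γ) (hr₀ : 0 < r₀) :
    Γ ⊆ closure {x | b x < 0} := by
  simpa using h.neg.subset_closure_pos hr₀

theorem hausdorffMeasure_eq_zero (h : IsTwoSided r₀ b Γ) (hr₀ : 0 < r₀) :
    Measure.hausdorffMeasure (d : ℝ) Γ = 0 := by
  have hH : (Measure.hausdorffMeasure (d : ℝ) : Measure (Eucl d)).IsAddHaarMeasure := by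
    simpa using isAddHaarMeasure_hausdorffMeasure (E := Eucl d)
  refine measure_eq_zero_of_tangent_ball h.isCompact.isClosed hr₀ fun x hx => ?_
  obtain ⟨ν, hν, h1, -⟩ := h.exists_normal x hx
  refine ⟨ν, hν, fun t ht htr => Set.disjoint_left.2 fun y hy hy' => ?_⟩
  have e1 := h.apply_add_smul hx hν h1 ht.le htr.le
  have e2 := LipschitzWith.sub_le_norm h.lipschitz (x + t • ν) y
  rw [(h.eq_zero_iff y).2 hy, e1, norm_sub_rev, ← dist_eq_norm] at e2
  rw [Metric.mem_ball] at hy'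
  linarith

theorem quadApprox (h : IsTwoSided r₀ b Γ) (hr₀ : 0 < r₀) {r : ℝ} (hr : r < r₀) :
    QuadApprox (2 * (r₀ - r))⁻¹ {x | |b x| ≤ r} b := by
  refine QuadApprox.of_exists fun x hx => ?_
  obtain ⟨ν, -, hν⟩ := h.exists_abs_sub_inner_le hr₀ hx hr
  exact ⟨innerSL ℝ ν, hν⟩

theorem frontier_eq (h : IsTwoSided r₀ b Γ) (hr₀ : 0 < r₀) : frontier {x | b x ≤ 0} = Γ := by
  have hb := h.lipschitz.continuous
  apply Subset.antisymm
  · intro x hx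
    rw [← h.eq_zero_iff]
    exact frontier_le_subset_eq hb continuous_const hx
  · intro x hx
    rw [frontier_eq_closure_inter_closure]
    refine ⟨subset_closure ((h.eq_zero_iff x).2 hx).le, ?_⟩
    refine closure_mono (fun y hy => ?_) (h.subset_closure_pos hr₀ hx)
    exact not_le.2 (show 0 < b y from hy)

/-- Off `Γ` and within the open tube, `d_Γ = |b|` with `b` differentiable and nonzero. -/
theorem le_reach (h : IsTwoSided r₀ b Γ) (hr₀ : 0 < r₀) : ENNReal.ofReal r₀ ≤ reach Γ := by
  refine le_of_forall_lt fun c hc => ?_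
  obtain ⟨r, hcr, hr⟩ := exists_between hc
  have hrt : r ≠ ⊤ := (hr.trans ENNReal.ofReal_lt_top).ne
  have hr0 : 0 < r.toReal := ENNReal.toReal_pos (zero_le.trans_lt hcr).ne' hrt
  have hrr : r.toReal < r₀ := by
    rwa [← ENNReal.ofReal_lt_ofReal_iff hr₀, ENNReal.ofReal_toReal hrt]
  refine hcr.trans_le (le_sSup ⟨r.toReal, ⟨hr0, fun x hx => ?_⟩, ENNReal.ofReal_toReal hrt⟩)
  have hbx : |b x| ≤ r.toReal := by rw [h.abs_eq]; exact hx.1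
  have hne : b x ≠ 0 := fun h0 => hx.2 ((h.eq_zero_iff x).1 h0)
  have hfun : (fun y => Metric.infDist y Γ) = fun y => |b y| := by
    ext y; rw [h.abs_eq]
  rw [hfun]
  exact (differentiableAt_abs hne).comp x (h.quadApprox hr₀ hrr x hbx).1

theorem isAdmissible (h : IsTwoSided r₀ b Γ) (hr₀ : 0 < r₀) (hD : {x | b x ≤ 0} ⊆ D) :
    IsAdmissible D r₀ {x | b x ≤ 0} := by
  have hb := h.lipschitz.continuous
  have hcl : IsClosed {x | b x ≤ 0} := isClosed_le hb continuous_const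
  refine ⟨hD, hcl, ?_, ?_, ?_, ?_⟩
  · obtain ⟨x, hx⟩ := h.nonempty
    exact ⟨x, ((h.eq_zero_iff x).2 hx).le⟩
  · refine Subset.antisymm hcl.closure_interior_subset fun x hx => ?_
    have hsub : {x | b x < 0} ⊆ interior {x | b x ≤ 0} :=
      interior_maximal (fun y hy => le_of_lt (show b y < 0 from hy)) (isOpen_lt hb continuous_const)
    rcases lt_or_eq_of_le (show b x ≤ 0 from hx) with h0 | h0
    · exact subset_closure (hsub h0)
    · exact closure_mono hsub (h.subset_closure_neg hr₀ ((h.eq_zero_iff x).1 h0))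
  · rw [h.frontier_eq hr₀]; exact h.le_reach hr₀
  · rw [h.frontier_eq hr₀]; exact h.hausdorffMeasure_eq_zero hr₀

end IsTwoSided

end Construction

/-! ### Compactness -/

section Compactness

open TopologicalSpace

theorem tendstoUniformly_infDist {X : Type*} [MetricSpace X] {K : ℕ → NonemptyCompacts X}
    {K' : NonemptyCompacts X} (h : Tendsto K atTop (𝓝 K')) :
    TendstoUniformly (fun n x => Metric.infDist x (K n : Set X))
      (fun x => Metric.infDist x (K' : Set X)) atTop := by
  rw [Metric.tendstoUniformly_iff]
  intro ε hε
  filter_upwards [Metric.tendsto_nhds.1 h ε hε] with n hn x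
  have hne (A B : NonemptyCompacts X) : Metric.hausdorffEDist (A : Set X) B ≠ ⊤ :=
    Metric.hausdorffEDist_ne_top_of_nonempty_of_bounded A.nonempty B.nonempty
      A.isCompact.isBounded B.isCompact.isBounded
  have h1 := Metric.infDist_le_infDist_add_hausdorffDist (x := x) (hne (K n) K')
  have h2 := Metric.infDist_le_infDist_add_hausdorffDist (x := x) (hne K' (K n))
  rw [Metric.hausdorffDist_comm] at h2
  rw [Metric.NonemptyCompacts.dist_eq] at hn
  rw [Real.dist_eq, abs_lt]
  constructor <;> linarith

/-- Blaschke selection: the nonempty compact subsets of `D` are compact for the Hausdorff distance,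
which controls distance functions uniformly. -/
theorem exists_subseq_tendstoUniformly_infDist {X : Type*} [MetricSpace X] {D : Set X}
    (hD : IsCompact D) {S : ℕ → Set X} (hS : ∀ n, IsClosed (S n)) (hne : ∀ n, (S n).Nonempty)
    (hSD : ∀ n, S n ⊆ D) :
    ∃ S' : Set X, IsCompact S' ∧ S'.Nonempty ∧ S' ⊆ D ∧ ∃ φ : ℕ → ℕ, StrictMono φ ∧
      TendstoUniformly (fun n x => Metric.infDist x (S (φ n))) (fun x => Metric.infDist x S')
        atTop := by
  obtain ⟨K, hK⟩ : ∃ K : ℕ → NonemptyCompacts X, ∀ n, (K n : Set X) = S n :=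
    ⟨fun n => ⟨⟨S n, hD.of_isClosed_subset (hS n) (hSD n)⟩, hne n⟩, fun n => rfl⟩
  have hc : IsCompact {L : NonemptyCompacts X | (L : Set X) ⊆ D} :=
    NonemptyCompacts.isCompact_subsets_of_isCompact hD
  obtain ⟨K', hK', φ, hφ, hlim⟩ := hc.tendsto_subseq (x := K)
    fun n => (hK n).le.trans (hSD n)
  refine ⟨K', K'.isCompact, K'.nonempty, hK', φ, hφ, ?_⟩
  have h := tendstoUniformly_infDist hlim
  simpa only [Function.comp_apply, hK] using h

variable {E : Type*} [NormedAddCommGroup E] [InnerProductSpace ℝ E]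

/-- Points of `Γ n` nearest to `x` converge to `x`, their unit normals subconverge, and the
inequalities at the ball centres pass to the limit. -/
theorem isTwoSided_of_tendstoUniformly [FiniteDimensional ℝ E] {r₀ : ℝ} {b : ℕ → E → ℝ}
    {b' : E → ℝ} {Γ : ℕ → Set E} {Γ' : Set E} (hb : ∀ n, IsTwoSided r₀ (b n) (Γ n))
    (hΓ' : IsCompact Γ') (hne : Γ'.Nonempty) (hu : TendstoUniformly b b' atTop)
    (hΓ : ∀ x, Tendsto (fun n => Metric.infDist x (Γ n)) atTop (𝓝 (Metric.infDist x Γ'))) :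
    IsTwoSided r₀ b' Γ' := by
  have : ProperSpace E := FiniteDimensional.proper ℝ E
  have hcont : Continuous b' :=
    hu.continuous (Eventually.of_forall fun n => (hb n).lipschitz.continuous).frequently
  refine ⟨hΓ', hne, ?_, fun x => ?_, fun x hx => ?_⟩
  · refine LipschitzWith.of_dist_le_mul fun x y => ?_
    exact le_of_tendsto ((hu.tendsto_at x).dist (hu.tendsto_at y))
      (Eventually.of_forall fun n => (hb n).lipschitz.dist_le_mul x y)
  · refine tendsto_nhds_unique (hu.tendsto_at x).abs ?_
    simpa only [(hb _).abs_eq] using hΓ x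
  · have hp : ∀ n, ∃ p ∈ Γ n, ∃ ν : E, ‖ν‖ = 1 ∧ r₀ ≤ b n (p + r₀ • ν) ∧
        b n (p - r₀ • ν) ≤ -r₀ ∧ Metric.infDist x (Γ n) = dist x p := by
      intro n
      obtain ⟨p, hp, hxp⟩ := (hb n).isCompact.isClosed.exists_infDist_eq_dist (hb n).nonempty x
      obtain ⟨ν, hν, h1, h2⟩ := (hb n).exists_normal p hp
      exact ⟨p, hp, ν, hν, h1, h2, hxp⟩
    choose p hpΓ ν hν h1 h2 hxp using hp
    have hplim : Tendsto p atTop (𝓝 x) := by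
      have := hΓ x
      rw [Metric.infDist_zero_of_mem hx] at this
      rw [tendsto_iff_dist_tendsto_zero]
      simpa only [hxp, dist_comm] using this
    obtain ⟨ν', hν', φ, hφ, hνlim⟩ := (isCompact_sphere (0 : E) 1).tendsto_subseq (x := ν)
      (fun n => by simpa using hν n)
    have hu' : TendstoUniformly (fun n => b (φ n)) b' atTop := fun s hs =>
      hφ.tendsto_atTop.eventually (hu s hs)
    have hp' : Tendsto (fun n => p (φ n)) atTop (𝓝 x) := hplim.comp hφ.tendsto_atTop
    have hν'' : Tendsto (fun n => r₀ • ν (φ n)) atTop (𝓝 (r₀ • ν')) := hνlim.const_smul r₀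
    refine ⟨ν', by simpa using hν', ?_, ?_⟩
    · exact ge_of_tendsto (hu'.tendsto_comp hcont.continuousAt (hp'.add hν''))
        (Eventually.of_forall fun n => h1 (φ n))
    · exact le_of_tendsto (hu'.tendsto_comp hcont.continuousAt (hp'.sub hν''))
        (Eventually.of_forall fun n => h2 (φ n))

variable {D : Set (Eucl d)} {r₀ : ℝ} {Ω : ℕ → Set (Eucl d)}

theorem exists_subseq_tendstoUniformly_signedDist (hD : IsCompact D) (hd : 0 < d) (hr₀ : 0 < r₀)
    (hΩ : ∀ n, IsAdmissible D r₀ (Ω n)) :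
    ∃ Ω', IsAdmissible D r₀ Ω' ∧ ∃ φ : ℕ → ℕ, StrictMono φ ∧
      TendstoUniformly (fun n => signedDist (Ω (φ n))) (signedDist Ω') atTop := by
  have hT : ∀ n, IsTwoSided r₀ (signedDist (Ω n)) (frontier (Ω n)) :=
    fun n => (hΩ n).isTwoSided hD hd hr₀
  obtain ⟨S, hS, hSne, hSD, φ, hφ, hφS⟩ := exists_subseq_tendstoUniformly_infDist hD
    (fun n => (hΩ n).isClosed) (fun n => (hΩ n).nonempty) (fun n => (hΩ n).subset)
  obtain ⟨Γ, hΓ, hΓne, -, ψ, hψ, hψΓ⟩ := exists_subseq_tendstoUniformly_infDist hD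
    (S := fun n => frontier (Ω (φ n))) (fun n => isClosed_frontier)
    (fun n => (hT (φ n)).nonempty) (fun n => (hΩ (φ n)).frontier_subset)
  have hψS : TendstoUniformly (fun n x => Metric.infDist x (Ω (φ (ψ n))))
      (fun x => Metric.infDist x S) atTop := fun s hs => hψ.tendsto_atTop.eventually (hφS s hs)
  have hne (n : ℕ) : (Ω n)ᶜ.Nonempty := (hΩ n).nonempty_compl hD hd
  set β : Eucl d → ℝ := fun x => 2 * Metric.infDist x S - Metric.infDist x Γ with hβ
  have hu : TendstoUniformly (fun n => signedDist (Ω (φ (ψ n)))) β atTop := by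
    have e : (fun n => signedDist (Ω (φ (ψ n)))) = fun n x =>
        2 * Metric.infDist x (Ω (φ (ψ n))) - Metric.infDist x (frontier (Ω (φ (ψ n)))) := by
      ext n x
      exact signedDist_eq_two_mul_sub (hΩ _).nonempty (hne _) x
    rw [e]
    exact ((uniformContinuous_const_smul (2 : ℝ)).comp_tendstoUniformly hψS).fun_sub hψΓ
  have hβT : IsTwoSided r₀ β Γ :=
    isTwoSided_of_tendstoUniformly (fun n => hT (φ (ψ n))) hΓ hΓne hu hψΓ.tendsto_at
  -- The identity `d_Ω = max(b, 0)` passes to the limit.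
  have hSβ : {x | β x ≤ 0} = S := by
    ext x
    have hmax : Metric.infDist x S = max (β x) 0 := by
      refine tendsto_nhds_unique (hψS.tendsto_at x) ?_
      refine ((hu.tendsto_at x).max tendsto_const_nhds).congr fun n => ?_
      by_cases hx : x ∈ Ω (φ (ψ n))
      · rw [signedDist_of_mem (hne _) hx, Metric.infDist_zero_of_mem hx, max_eq_right]
        exact neg_nonpos.2 Metric.infDist_nonneg
      · rw [signedDist, Metric.infDist_zero_of_mem (s := (Ω (φ (ψ n)))ᶜ) hx, sub_zero,
          max_eq_left Metric.infDist_nonneg]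
    rw [hS.isClosed.mem_iff_infDist_zero hSne, hmax, max_eq_right_iff]
    rfl
  have hadm := hβT.isAdmissible hr₀ (D := D) (by rw [hSβ]; exact hSD)
  refine ⟨_, hadm, φ ∘ ψ, hφ.comp hψ, ?_⟩
  -- A Hausdorff limit of frontiers need not be the frontier of the limit; two-sidedness of `β`
  -- ensures that it is.
  have e : signedDist {x | β x ≤ 0} = β := by
    ext x
    rw [signedDist_eq_two_mul_sub hadm.nonempty (hadm.nonempty_compl hD hd),
      hβT.frontier_eq hr₀, hSβ]
  rw [e]
  exact hu

theorem rConverges_of_tendstoUniformly {Ω' : Set (Eucl d)} (hD : IsCompact D) (hd : 0 < d)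
    (hr₀ : 0 < r₀) (hΩ : ∀ n, IsAdmissible D r₀ (Ω n)) (hΩ' : IsAdmissible D r₀ Ω')
    (hu : TendstoUniformly (fun n => signedDist (Ω n)) (signedDist Ω') atTop) :
    RConverges D r₀ Ω Ω' := by
  have hT n := (hΩ n).isTwoSided hD hd hr₀
  have hT' := hΩ'.isTwoSided hD hd hr₀
  have htube (r : ℝ) : tube r (frontier Ω') = {x | |signedDist Ω' x| ≤ r} := by
    ext x
    rw [mem_ofPred_eq, hT'.abs_eq]
    rfl
  have hquad (r : ℝ) (hr : r < r₀) : ∃ K, 0 ≤ K ∧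
      (∀ᶠ n in atTop, QuadApprox K (tube r (frontier Ω')) (signedDist (Ω n))) ∧
      QuadApprox K (tube r (frontier Ω')) (signedDist Ω') := by
    -- The intermediate radius leaves room for uniform convergence: eventually `|b_n| ≤ s` wherever
    -- `|b_∞| ≤ r`, so one Taylor constant serves all large `n`.
    obtain ⟨s, hrs, hs⟩ := exists_between hr
    refine ⟨(2 * (r₀ - s))⁻¹, inv_nonneg.2 (by linarith), ?_, ?_⟩
    · filter_upwards [Metric.tendstoUniformly_iff.1 hu (s - r) (by linarith)] with n hn
      refine ((hT n).quadApprox hr₀ hs).mono fun x hx => ?_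
      rw [htube] at hx
      have h1 := (hn x).le
      have h2 : |signedDist Ω' x| ≤ r := hx
      rw [Real.dist_eq] at h1
      change |_| ≤ s
      rw [abs_le] at h1 h2 ⊢
      constructor <;> linarith
    · refine (hT'.quadApprox hr₀ hs).mono fun x hx => ?_
      rw [htube] at hx
      exact le_trans hx hrs.le
  have hbound (r : ℝ) : ∀ x ∈ tube r (frontier Ω'), |signedDist Ω' x| ≤ r := fun x hx => by
    rw [htube] at hx; exact hx
  refine ⟨hu.tendstoUniformlyOn, fun r hr hrr α hα => ?_, fun r hr hrr => ?_⟩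
  · obtain ⟨K, hK, hq, hq'⟩ := hquad r hrr
    exact tendstoC1Holder_of_tendstoUniformly hK hq hq' (fun n => (hT n).lipschitz) hT'.lipschitz
      hu (hbound r) hα
  · obtain ⟨K, hK, hq, hq'⟩ := hquad r hrr
    obtain ⟨x, hx⟩ := hT'.nonempty
    refine tendstoWeakStarW2Inf_of_tendstoUniformly hK hq hq' (fun n => (hT n).lipschitz)
      hT'.lipschitz hu (hbound r) ⟨x, ?_⟩ isOpen_interior interior_subset
    change Metric.infDist x _ ≤ r
    rw [Metric.infDist_zero_of_mem hx]
    exact hr.le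

end Compactness

end RConv

end

theorem mainTheorem4 {d : ℕ} (hd : 0 < d) {r₀ : ℝ} (hr₀ : 0 < r₀)
    {D : Set (RConv.Eucl d)} (hD : IsCompact D) (hDne : D.Nonempty)
    (Ω : ℕ → Set (RConv.Eucl d)) (hΩ : ∀ n, Ω n ∈ RConv.admissibleShapes D r₀) :
    ∃ Ω' ∈ RConv.admissibleShapes D r₀, ∃ φ : ℕ → ℕ, StrictMono φ ∧
      RConv.RConverges D r₀ (fun n => Ω (φ n)) Ω' := by
  obtain ⟨Ω', hΩ', φ, hφ, hu⟩ :=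
    RConv.exists_subseq_tendstoUniformly_signedDist hD hd hr₀ hΩ
  exact ⟨Ω', hΩ', φ, hφ,
    RConv.rConverges_of_tendstoUniformly hD hd hr₀ (fun n => hΩ (φ n)) hΩ' hu⟩
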